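/- Let $R=\mathbb{K}[x_1,\dots,x_n]$ over a field $\mathbb{K}$ with a fixed monomial order, let $f_1,\dots,f_r\in R$, and put $I_i=\langle f_1,\dots,f_i\rangle$. Write $\operatorname{lm}$, $\operatorname{lt}$ for the leading monomial and leading term of a nonzero polynomial. A \emph{signature} is a pair $(i,u)$ with $1\le i\le r$ and $u$ a monomial; signatures are ordered by index first and then by the monomial order, $a(i,u)=(i,au)$, and $\sigma$ divides $\tau$ if $\tau=a\sigma$ for a monomial $a$. An \emph{extended sig-poly pair} is a triple $\alpha=(\operatorname{poly}(\alpha),\mathfrak{s}(\alpha),\operatorname{quo}(\alpha))$ of a polynomial, a signature with index $\operatorname{ind}(\alpha)$ and a polynomial, such that $\operatorname{lm}(\operatorname{quo}(\alpha))$ is the monomial of $\mathfrak{s}(\alpha)$ and $\operatorname{poly}(\alpha)-\operatorname{quo}(\alpha)f_{\operatorname{ind}(\alpha)}\in I_{\operatorname{ind}(\alpha)-1}$. For $\alpha,\beta$ with nonzero polynomial parts let $c=\operatorname{lcm}(\operatorname{lm}(\operatorname{poly}(\alpha)),\operatorname{lm}(\operatorname{poly}(\beta)))$, $a=c/\operatorname{lt}(\operatorname{poly}(\alpha))$,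 $b=c/\operatorname{lt}(\operatorname{poly}(\beta))$ (in products with signatures, coefficients are ignored). They form a \emph{regular S-pair} if $\mathfrak{s}(a\alpha)\ne\mathfrak{s}(b\beta)$. Ordered so that $\mathfrak{s}(\alpha)\ge\mathfrak{s}(\beta)$, their S-pair has polynomial part $a\operatorname{poly}(\alpha)-b\operatorname{poly}(\beta)$, signature $\max(a\,\mathfrak{s}(\alpha),b\,\mathfrak{s}(\beta))$, and quotient $a\operatorname{quo}(\alpha)$ if $\operatorname{ind}(\alpha)>\operatorname{ind}(\beta)$ and $a\operatorname{quo}(\alpha)-b\operatorname{quo}(\beta)$ if the indices are equal. \emph{Regular reduction} of $\gamma$ by $G$: as long as $\operatorname{poly}(\gamma)\neq0$ and there is $\beta\in G$ with $\operatorname{poly}(\beta)\ne0$, $\operatorname{lm}(\operatorname{poly}(\beta))\mid\operatorname{lm}(\operatorname{poly}(\gamma))$ and $b\,\mathfrak{s}(\beta)<\mathfrak{s}(\gamma)$, where $b=\operatorname{lt}(\operatorname{poly}(\gamma))/\operatorname{lt}(\operatorname{poly}(\beta))$, choose such a $\beta$, replace $\operatorname{poly}(\gamma)$ by $\operatorname{poly}(\gamma)-b\operatorname{poly}(\beta)$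 and, if $\operatorname{ind}(\beta)=\operatorname{ind}(\gamma)$, replace $\operatorname{quo}(\gamma)$ by $\operatorname{quo}(\gamma)-b\operatorname{quo}(\beta)$; the signature is kept. For $\alpha\in G$ and a monomial $a$, the multiple $a\alpha$ is \emph{rewritable} if some $\delta\in G$ satisfies one of: $\mathfrak{s}(\delta)$ divides $a\,\mathfrak{s}(\alpha)$ and $\delta$ was added to $G$ later than $\alpha$ (singular criterion); $\mathfrak{s}(\delta)$ divides $a\,\mathfrak{s}(\alpha)$ and $\operatorname{poly}(\delta)=0$ (syzygy criterion); $\operatorname{ind}(\delta)<\operatorname{ind}(\alpha)$, $\operatorname{poly}(\delta)\neq0$ and $\operatorname{lm}(\operatorname{poly}(\delta))$ divides $\operatorname{lm}(a\operatorname{quo}(\alpha))$ (Koszul criterion). The \emph{algorithm}: start with $G=\{(f_i,(i,1),1): 1\le i\le r\}$, $S_1=\dots=S_r=\varnothing$, and $P$ the set of all regular S-pairs of elements of $G$. While $P\ne\varnothing$: remove from $P$ a pair $(\alpha,\beta)$ whose S-pair has minimal signature. If one of $a\alpha$, $b\beta$ ($a,b$ the monomials of the S-pair) is rewritable, discard the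 pair. Otherwise let $\gamma$ be a regular reduction of its S-pair by $G$ and add $\gamma$ to $G$; if $\operatorname{poly}(\gamma)\ne0$, add to $P$ all regular S-pairs of $\gamma$ with elements of $G$; if $\operatorname{poly}(\gamma)=0$, insert $\operatorname{quo}(\gamma)$ into $S_{\operatorname{ind}(\gamma)}$. When $P=\varnothing$, return $\{\operatorname{poly}(\beta):\beta\in G\}$ and $S_1,\dots,S_r$. \textbf{Theorem.} On every input $f_1,\dots,f_r\in R$ the algorithm terminates, whatever choices are made (among the pairs of minimal signature and among the reducers), and for every run: (i) the returned set $\{\operatorname{poly}(\beta):\beta\in G\}$ is a Gröbner basis of $\langle f_1,\dots,f_r\rangle$; (ii) $I_{i-1}+\langle S_i\rangle=I_{i-1}:f_i$ for every $i$ with $f_i\neq 0$. Moreover, whenever a polynomial $g$ is inserted into some $S_i$ in the course of a run, $g\neq0$ and $\operatorname{lm}(g)$ is not divisible by the leading monomial of any nonzero element of $I_{i-1}$ or of any element previously inserted into $S_i$. -/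

import Mathlib

open scoped MonomialOrder

namespace SGB

noncomputable section

/-- A signature `(i, u)`: an index and (the exponent of) a monomial. -/
abbrev Signature (n r : ℕ) : Type := Fin r × (Fin n →₀ ℕ)

namespace Signature

variable {n r : ℕ}

/-- Index first, then the monomial order. -/
def lt (m : MonomialOrder (Fin n)) (s t : Signature n r) : Prop :=
  s.1 < t.1 ∨ (s.1 = t.1 ∧ s.2 ≺[m] t.2)

/-- The product of a monomial and a signature. -/
def mul (a : Fin n →₀ ℕ) (s : Signature n r) : Signature n r := (s.1, a + s.2)

def divides (s t : Signature n r) : Prop := ∃ a : Fin n →₀ ℕ, mul a s = t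

open Classical in
/-- The larger one of two signatures. -/
def max (m : MonomialOrder (Fin n)) (s t : Signature n r) : Signature n r :=
  if lt m s t then t else s

end Signature

/-- The data of an extended sig-poly pair `(poly, sig, quo)`. The algorithm below starts from
triples with `lm(quo) = sig.2` and `poly - quo * f_i ∈ ⟨f_j : j < i⟩`, `i = sig.1`, and its
operations preserve these two properties. -/
structure SigPoly (K : Type*) [Field K] (n r : ℕ) where
  poly : MvPolynomial (Fin n) K
  sig : Signature n r
  quo : MvPolynomial (Fin n) K

variable {K : Type*} [Field K] {n r : ℕ}

namespace SigPoly

/-- The index of a sig-poly pair. -/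
abbrev ind (α : SigPoly K n r) : Fin r := α.sig.1

end SigPoly

/-- The exponent of `lcm(lm(p), lm(q)) / lm(p)`. -/
def cofactor (m : MonomialOrder (Fin n)) (p q : MvPolynomial (Fin n) K) : Fin n →₀ ℕ :=
  (m.degree p ⊔ m.degree q) - m.degree p

/-- The term `lcm(lm(p), lm(q)) / lt(p)`. -/
def cofactorTerm (m : MonomialOrder (Fin n)) (p q : MvPolynomial (Fin n) K) :
    MvPolynomial (Fin n) K :=
  MvPolynomial.monomial (cofactor m p q) (m.leadingCoeff p)⁻¹

/-- `α` and `β` form a regular S-pair. -/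
def IsRegularPair (m : MonomialOrder (Fin n)) (α β : SigPoly K n r) : Prop :=
  α.poly ≠ 0 ∧ β.poly ≠ 0 ∧
    Signature.mul (cofactor m α.poly β.poly) α.sig ≠
      Signature.mul (cofactor m β.poly α.poly) β.sig

/-- The S-pair of `α` and `β`, where the signature of `α` is at least that of `β`. -/
def sPairOrdered (m : MonomialOrder (Fin n)) (α β : SigPoly K n r) : SigPoly K n r where
  poly := cofactorTerm m α.poly β.poly * α.poly - cofactorTerm m β.poly α.poly * β.poly
  sig := Signature.max m (Signature.mul (cofactor m α.poly β.poly) α.sig)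
    (Signature.mul (cofactor m β.poly α.poly) β.sig)
  quo := if β.ind < α.ind then cofactorTerm m α.poly β.poly * α.quo
    else cofactorTerm m α.poly β.poly * α.quo - cofactorTerm m β.poly α.poly * β.quo

open Classical in
/-- The S-pair of `α` and `β`, the one with the larger signature being put first. -/
def sPair (m : MonomialOrder (Fin n)) (α β : SigPoly K n r) : SigPoly K n r :=
  if Signature.lt m α.sig β.sig then sPairOrdered m β α else sPairOrdered m α β

/-- The term `lt(p) / lt(q)`, for `lm(q) ∣ lm(p)`. -/
def ltQuot (m : MonomialOrder (Fin n)) (p q : MvPolynomial (Fin n) K) : MvPolynomial (Fin n) K :=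
  MvPolynomial.monomial (m.degree p - m.degree q) (m.leadingCoeff p / m.leadingCoeff q)

/-- One pass through the loop of regular reduction: the leading term of `γ` is cancelled by a
multiple of an element of `G`, this multiple having a smaller signature than `γ`. -/
def RegRedStep (m : MonomialOrder (Fin n)) (G : List (SigPoly K n r)) (γ γ' : SigPoly K n r) :
    Prop :=
  ∃ β ∈ G, γ.poly ≠ 0 ∧ β.poly ≠ 0 ∧ m.degree β.poly ≤ m.degree γ.poly ∧
    Signature.lt m (Signature.mul (m.degree γ.poly - m.degree β.poly) β.sig) γ.sig ∧
    γ'.poly = γ.poly - ltQuot m γ.poly β.poly * β.poly ∧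
    γ'.sig = γ.sig ∧
    (β.ind = γ.ind → γ'.quo = γ.quo - ltQuot m γ.poly β.poly * β.quo) ∧
    (β.ind ≠ γ.ind → γ'.quo = γ.quo)

/-- The rewritability check for `a α`, where `α` is the entry at position `k` of the list `G`, in
which the elements stand in the order in which they were added. The three alternatives are the
singular, the syzygy and the Koszul criterion. -/
def Rewritable (m : MonomialOrder (Fin n)) (G : List (SigPoly K n r)) (k : ℕ)
    (α : SigPoly K n r) (a : Fin n →₀ ℕ) : Prop :=
  ∃ (j : ℕ) (δ : SigPoly K n r), G[j]? = some δ ∧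
    ((Signature.divides δ.sig (Signature.mul a α.sig) ∧ k < j) ∨
     (Signature.divides δ.sig (Signature.mul a α.sig) ∧ δ.poly = 0) ∨
     (δ.ind < α.ind ∧ δ.poly ≠ 0 ∧
        m.degree δ.poly ≤ m.degree (MvPolynomial.monomial a (1 : K) * α.quo)))

/-- The variables of the algorithm: the list `G` of sig-poly pairs in the order of their insertion,
the set `P` of S-pairs that wait, each given by the positions of its two members in `G` (the larger
position first), and the sets `S i` of recorded quotients. -/
structure Vars (K : Type*) [Field K] (n r : ℕ) where
  G : List (SigPoly K n r)
  P : Set (ℕ × ℕ)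
  S : Fin r → Set (MvPolynomial (Fin n) K)

/-- The positions `(k, l)`, `l < k`, in `G` of the regular S-pairs. -/
def regularPairs (m : MonomialOrder (Fin n)) (G : List (SigPoly K n r)) : Set (ℕ × ℕ) :=
  {p | p.2 < p.1 ∧ ∃ α β, G[p.1]? = some α ∧ G[p.2]? = some β ∧ IsRegularPair m α β}

/-- A state of the algorithm: it is at the head of the main loop, or it is inside the regular
reduction of an S-pair, of which `γ` is the current remainder. -/
inductive State (K : Type*) [Field K] (n r : ℕ) where
  | main (v : Vars K n r) : State K n r
  | reducing (v : Vars K n r) (γ : SigPoly K n r) : State K n r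

/-- The sig-poly pairs `(f_i, (i, 1), 1)`. -/
def initG (f : Fin r → MvPolynomial (Fin n) K) : List (SigPoly K n r) :=
  List.ofFn fun i => { poly := f i, sig := (i, 0), quo := 1 }

/-- The state in which the algorithm enters its main loop. -/
def init (m : MonomialOrder (Fin n)) (f : Fin r → MvPolynomial (Fin n) K) : State K n r :=
  State.main { G := initG f, P := regularPairs m (initG f), S := fun _ => ∅ }

/-- `(α, β)`, at the positions `(k, l)`, is a pair in `P` whose S-pair has minimal signature. -/
def IsMinimalPair (m : MonomialOrder (Fin n)) (v : Vars K n r) (k l : ℕ)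
    (α β : SigPoly K n r) : Prop :=
  (k, l) ∈ v.P ∧ v.G[k]? = some α ∧ v.G[l]? = some β ∧
    ∀ (k' l' : ℕ) (α' β' : SigPoly K n r), (k', l') ∈ v.P →
      v.G[k']? = some α' → v.G[l']? = some β' →
        ¬ Signature.lt m (sPair m α' β').sig (sPair m α β).sig

/-- One of the two multiples that make up the S-pair of `α` and `β` is rewritable. -/
def PairRewritable (m : MonomialOrder (Fin n)) (v : Vars K n r) (k l : ℕ)
    (α β : SigPoly K n r) : Prop :=
  Rewritable m v.G k α (cofactor m α.poly β.poly) ∨ Rewritable m v.G l β (cofactor m β.poly α.poly)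

/-- The steps of the algorithm. Where the algorithm leaves a choice (among the pairs of minimal
signature, among the reducers), every choice gives a step. -/
inductive Step (m : MonomialOrder (Fin n)) : State K n r → State K n r → Prop
  /-- A pair of minimal signature is removed from `P` and discarded. -/
  | discard (v : Vars K n r) (k l : ℕ) (α β : SigPoly K n r)
      (hmin : IsMinimalPair m v k l α β) (hrw : PairRewritable m v k l α β) :
      Step m (State.main v) (State.main { v with P := v.P \ {(k, l)} })
  /-- A pair of minimal signature is removed from `P` and its regular reduction begins. -/
  | select (v : Vars K n r) (k l : ℕ) (α β : SigPoly K n r)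
      (hmin : IsMinimalPair m v k l α β) (hrw : ¬ PairRewritable m v k l α β) :
      Step m (State.main v) (State.reducing { v with P := v.P \ {(k, l)} } (sPair m α β))
  /-- A step of the regular reduction. -/
  | reduce (v : Vars K n r) (γ γ' : SigPoly K n r) (h : RegRedStep m v.G γ γ') :
      Step m (State.reducing v γ) (State.reducing v γ')
  /-- The regular reduction has ended with a nonzero polynomial part: `γ` is added to `G` and its
  regular S-pairs with the elements of `G` are added to `P`. -/
  | insert (v : Vars K n r) (γ : SigPoly K n r) (hirr : ∀ γ', ¬ RegRedStep m v.G γ γ')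
      (hγ : γ.poly ≠ 0) :
      Step m (State.reducing v γ)
        (State.main
          { G := v.G ++ [γ]
            P := v.P ∪ {p | p ∈ regularPairs m (v.G ++ [γ]) ∧ p.1 = v.G.length}
            S := v.S })
  /-- The regular reduction has ended with zero: `γ` is added to `G` and its quotient is recorded. -/
  | record (v : Vars K n r) (γ : SigPoly K n r) (hγ : γ.poly = 0) :
      Step m (State.reducing v γ)
        (State.main
          { G := v.G ++ [γ]
            P := v.P
            S := Function.update v.S γ.ind (v.S γ.ind ∪ {γ.quo}) })

/-- The state `s` occurs in some run of the algorithm on the input `f`. -/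
def Reachable (m : MonomialOrder (Fin n)) (f : Fin r → MvPolynomial (Fin n) K)
    (s : State K n r) : Prop :=
  Relation.ReflTransGen (Step m) (init m f) s

/-- The set of the polynomial parts of the elements of `G`. -/
def polys (G : List (SigPoly K n r)) : Set (MvPolynomial (Fin n) K) :=
  {p | ∃ α ∈ G, α.poly = p}

/-- The ideal generated by the leading monomials of the nonzero elements of `A`. -/
def leadIdeal (m : MonomialOrder (Fin n)) (A : Set (MvPolynomial (Fin n) K)) :
    Ideal (MvPolynomial (Fin n) K) :=
  Ideal.span {t | ∃ p ∈ A, p ≠ 0 ∧ t = MvPolynomial.monomial (m.degree p) (1 : K)}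

/-- `B` is a Gröbner basis of the ideal `I`. -/
def IsGroebnerBasis (m : MonomialOrder (Fin n)) (I : Ideal (MvPolynomial (Fin n) K))
    (B : Set (MvPolynomial (Fin n) K)) : Prop :=
  B.Finite ∧ B ⊆ I ∧ leadIdeal m B = leadIdeal m (I : Set (MvPolynomial (Fin n) K))

/-- The ideal `⟨f_j : j < i⟩`. -/
def idealBelow (f : Fin r → MvPolynomial (Fin n) K) (i : Fin r) :
    Ideal (MvPolynomial (Fin n) K) :=
  Ideal.span {p | ∃ j, j < i ∧ f j = p}

end

end SGB

/-!
Call a nonzero polynomial with signature `τ` reduced if its leading monomial does not occur at a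
smaller signature; up to a nonzero constant, its leading term is then determined by `τ`. Once the
S-pairs with signature below a bound have been treated, for every signature `τ` below the bound
either the syzygy or the Koszul criterion detects a syzygy of signature `τ`, or the multiple of
signature `τ` of its canonical rewriter is reduced: otherwise this multiple could be reduced by a
multiple of a canonical rewriter of a smaller signature, and the S-pair of these two rewriters would
have produced a later rewriter of `τ`. So every leading monomial of the ideal is a multiple of one
in `G`, and every leading monomial of a syzygy comes from a recorded quotient or a Koszul syzygy.

For termination, Dickson's lemma bounds the number of elements with zero polynomial part and shows
that the ratio of the signature to the leading monomial takes finitely many values on the inserted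
elements. This ratio strictly increases from the parent of an inserted element, the member of its
S-pair with the larger multiple, to the element. By Dickson's lemma again a parent has finitely many
children, since their signatures do not divide each other, so the tree of insertions is finite.
-/

namespace SGB

open MvPolynomial

namespace Signature

variable {n r : ℕ} {m : MonomialOrder (Fin n)} {ρ σ τ : Signature n r} {a b : Fin n →₀ ℕ}

/-- The order isomorphism from signatures to the lexicographic product of indices and monomials:
through it, comparing signatures becomes comparing elements of a well-founded linear order. -/
noncomputable def key (m : MonomialOrder (Fin n)) (σ : Signature n r) : Fin r ×ₗ m.syn :=
  toLex (σ.1, m.toSyn σ.2)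

lemma lt_iff_key_lt : lt m σ τ ↔ key m σ < key m τ := by
  simp [lt, key, Prod.Lex.toLex_lt_toLex]

lemma key_injective : Function.Injective (key m : Signature n r → _) := by
  rintro ⟨i, u⟩ ⟨j, v⟩ h
  simpa [key] using h

lemma key_lt_key_of_fst_lt (h : σ.1 < τ.1) : key m σ < key m τ :=
  lt_iff_key_lt.1 (.inl h)

lemma key_lt_key_iff_of_fst_eq (h : σ.1 = τ.1) : key m σ < key m τ ↔ σ.2 ≺[m] τ.2 := by
  simp [← lt_iff_key_lt, lt, h]

lemma fst_le_of_key_le (h : key m σ ≤ key m τ) : σ.1 ≤ τ.1 :=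
  Prod.Lex.monotone_fst (key m σ) (key m τ) h

lemma mul_mul : mul a (mul b σ) = mul (a + b) σ := by simp [mul, add_assoc]

lemma key_mul_lt_key_mul : key m (mul a σ) < key m (mul a τ) ↔ key m σ < key m τ := by
  simp [← lt_iff_key_lt, lt, mul]

lemma divides_iff : divides σ τ ↔ σ.1 = τ.1 ∧ σ.2 ≤ τ.2 where
  mp := by
    rintro ⟨a, rfl⟩
    exact ⟨rfl, le_add_self⟩
  mpr h := ⟨τ.2 - σ.2, Prod.ext h.1 (tsub_add_cancel_of_le h.2)⟩

lemma divides.trans (h : divides ρ σ) (h' : divides σ τ) : divides ρ τ := by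
  obtain ⟨a, rfl⟩ := h
  obtain ⟨b, rfl⟩ := h'
  exact ⟨b + a, mul_mul.symm⟩

instance : IsPreorder (Signature n r) divides where
  refl _ := divides_iff.2 ⟨rfl, le_rfl⟩
  trans _ _ _ := divides.trans

lemma divides.key_le (h : divides σ τ) : key m σ ≤ key m τ := by
  obtain ⟨hind, hle⟩ := divides_iff.1 h
  exact Prod.Lex.toLex_le_toLex.2 (.inr ⟨hind, m.toSyn_monotone hle⟩)

lemma wellQuasiOrdered_divides :
    WellQuasiOrdered (divides : Signature n r → Signature n r → Prop) :=
  fun x => by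
    obtain ⟨i, j, hij, h⟩ := (Finite.wellQuasiOrdered (· = ·)).prod wellQuasiOrdered_le x
    exact ⟨i, j, hij, divides_iff.2 h⟩

lemma max_of_key_lt (h : key m σ < key m τ) : max m σ τ = τ :=
  if_pos (lt_iff_key_lt.2 h)

lemma max_of_key_gt (h : key m τ < key m σ) : max m σ τ = σ :=
  if_neg fun h' => (lt_iff_key_lt.1 h').not_gt h

lemma max_comm : max m σ τ = max m τ σ := by
  rcases lt_trichotomy (key m σ) (key m τ) with h | h | h
  · rw [max_of_key_lt h, max_of_key_gt h]
  · rw [key_injective h]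
  · rw [max_of_key_lt h, max_of_key_gt h]

end Signature

open Signature (key)

section Degree

variable {ι K : Type*} [Field K] {m : MonomialOrder ι} {p q : MvPolynomial ι K}

lemma degree_monomial_mul {a : ι →₀ ℕ} {c : K} (hc : c ≠ 0) (hp : p ≠ 0) :
    m.degree (monomial a c * p) = a + m.degree p := by
  classical
  rw [m.degree_mul (by simpa using hc) hp, m.degree_monomial, if_neg hc]

lemma sub_ne_zero_and_degree_sub_of_lt (h : m.degree q ≺[m] m.degree p) :
    p - q ≠ 0 ∧ m.degree (p - q) = m.degree p :=
  ⟨sub_ne_zero.2 fun hpq => h.ne (by rw [hpq]), m.degree_sub_of_lt h⟩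

lemma leadingCoeff_monomial_mul {a : ι →₀ ℕ} {c : K} :
    m.leadingCoeff (monomial a c * p) = c * m.leadingCoeff p := by
  rw [m.leadingCoeff_mul, m.leadingCoeff_monomial]

lemma degree_sub_lt (hdeg : m.degree q = m.degree p) (hlc : m.leadingCoeff q = m.leadingCoeff p)
    (hne : p - q ≠ 0) : m.degree (p - q) ≺[m] m.degree p := by
  refine lt_of_le_of_ne (m.degree_sub_le.trans (by simp [hdeg])) fun heq => hne ?_
  rw [← m.coeff_degree_eq_zero_iff, m.toSyn.injective heq, coeff_sub, sub_eq_zero]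
  simpa only [MonomialOrder.leadingCoeff, hdeg] using hlc.symm

end Degree

section LtQuot

variable {K : Type*} [Field K] {n : ℕ} {m : MonomialOrder (Fin n)} {p q : MvPolynomial (Fin n) K}

lemma degree_sub_ltQuot_mul_lt (hq : q ≠ 0) (hle : m.degree q ≤ m.degree p)
    (hne : p - ltQuot m p q * q ≠ 0) : m.degree (p - ltQuot m p q * q) ≺[m] m.degree p := by
  have hp : p ≠ 0 := by
    rintro rfl
    simp [ltQuot] at hne
  have hlcq : m.leadingCoeff q ≠ 0 := m.leadingCoeff_ne_zero_iff.2 hq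
  have hc : m.leadingCoeff p / m.leadingCoeff q ≠ 0 :=
    div_ne_zero (m.leadingCoeff_ne_zero_iff.2 hp) hlcq
  refine degree_sub_lt ?_ ?_ hne
  · rw [ltQuot, degree_monomial_mul hc hq, tsub_add_cancel_of_le hle]
  · rw [ltQuot, leadingCoeff_monomial_mul, div_mul_cancel₀ _ hlcq]

end LtQuot

section Representations

variable {K : Type*} [Field K] {n r : ℕ} {m : MonomialOrder (Fin n)}
  {f : Fin r → MvPolynomial (Fin n) K} {p p' : MvPolynomial (Fin n) K}
  {σ τ : Signature n r} {α β : SigPoly K n r} {a e : Fin n →₀ ℕ} {c : K} {i j : Fin r}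

lemma mem_idealBelow (h : j < i) : f j ∈ idealBelow f i :=
  Ideal.subset_span ⟨j, h, rfl⟩

lemma idealBelow_mono (h : i ≤ j) : idealBelow f i ≤ idealBelow f j :=
  Ideal.span_mono fun _ ⟨k, hk, hp⟩ => ⟨k, hk.trans_le h, hp⟩

namespace SigPoly

/-- An extended sig-poly pair: the quotient has the monomial of the signature as its leading
monomial and represents the polynomial part modulo the generators of smaller index. -/
structure IsValid (m : MonomialOrder (Fin n)) (f : Fin r → MvPolynomial (Fin n) K)
    (α : SigPoly K n r) : Prop where
  quo_ne_zero : α.quo ≠ 0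
  degree_quo : m.degree α.quo = α.sig.2
  sub_mul_mem : α.poly - α.quo * f α.ind ∈ idealBelow f α.ind

/-- The multiple of `α` by the term `c * x ^ a`. -/
noncomputable def termMul (a : Fin n →₀ ℕ) (c : K) (α : SigPoly K n r) : SigPoly K n r where
  poly := monomial a c * α.poly
  sig := Signature.mul a α.sig
  quo := monomial a c * α.quo

lemma IsValid.termMul (h : IsValid m f α) (hc : c ≠ 0) : IsValid m f (termMul a c α) where
  quo_ne_zero := mul_ne_zero (by simpa using hc) h.quo_ne_zero
  degree_quo := by
    simp [SigPoly.termMul, degree_monomial_mul hc h.quo_ne_zero, h.degree_quo, Signature.mul]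
  sub_mul_mem := by
    change monomial a c * α.poly - monomial a c * α.quo * f α.ind ∈ idealBelow f α.ind
    convert Ideal.mul_mem_left _ (monomial a c) h.sub_mul_mem using 1
    ring

lemma IsValid.neg (h : IsValid m f α) : IsValid m f ⟨-α.poly, α.sig, -α.quo⟩ where
  quo_ne_zero := neg_ne_zero.2 h.quo_ne_zero
  degree_quo := m.degree_neg.trans h.degree_quo
  sub_mul_mem := by
    convert neg_mem h.sub_mul_mem using 1
    ring

lemma IsValid.mem_idealBelow (h : IsValid m f α) (hi : α.ind < i) : α.poly ∈ idealBelow f i := by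
  simpa using add_mem (idealBelow_mono hi.le h.sub_mul_mem)
    (Ideal.mul_mem_left _ α.quo (SGB.mem_idealBelow (f := f) hi))

lemma IsValid.mem_span_range (h : IsValid m f α) : α.poly ∈ Ideal.span (Set.range f) := by
  have hle : idealBelow f α.ind ≤ Ideal.span (Set.range f) :=
    Ideal.span_mono fun _ ⟨k, _, hp⟩ => ⟨k, hp⟩
  simpa using add_mem (hle h.sub_mul_mem)
    (Ideal.mul_mem_left _ α.quo (Ideal.subset_span ⟨α.ind, rfl⟩))

lemma IsValid.sub_of_ind_eq (hα : IsValid m f α) (hβ : IsValid m f β) (hind : β.ind = α.ind)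
    (hlt : key m β.sig < key m α.sig) :
    IsValid m f ⟨α.poly - β.poly, α.sig, α.quo - β.quo⟩ := by
  have hdeg : m.degree β.quo ≺[m] m.degree α.quo := by
    rwa [hα.degree_quo, hβ.degree_quo, ← Signature.key_lt_key_iff_of_fst_eq hind]
  obtain ⟨hne, heq⟩ := sub_ne_zero_and_degree_sub_of_lt hdeg
  refine ⟨hne, heq.trans hα.degree_quo, ?_⟩
  have hβmem : β.poly - β.quo * f α.ind ∈ idealBelow f α.ind := hind ▸ hβ.sub_mul_mem
  convert sub_mem hα.sub_mul_mem hβmem using 1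
  ring

lemma IsValid.sub_of_ind_lt (hα : IsValid m f α) (hβ : IsValid m f β) (hind : β.ind < α.ind) :
    IsValid m f ⟨α.poly - β.poly, α.sig, α.quo⟩ where
  quo_ne_zero := hα.quo_ne_zero
  degree_quo := hα.degree_quo
  sub_mul_mem := by
    convert sub_mem hα.sub_mul_mem (hβ.mem_idealBelow hind) using 1
    ring

end SigPoly

/-- `p` is the polynomial part of an extended sig-poly pair of signature `τ`. -/
def HasSig (m : MonomialOrder (Fin n)) (f : Fin r → MvPolynomial (Fin n) K) (τ : Signature n r)
    (p : MvPolynomial (Fin n) K) : Prop :=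
  ∃ q, SigPoly.IsValid m f ⟨p, τ, q⟩

/-- `e` is the leading exponent of a polynomial that has a signature smaller than `τ`. -/
def SigLM (m : MonomialOrder (Fin n)) (f : Fin r → MvPolynomial (Fin n) K) (τ : Signature n r)
    (e : Fin n →₀ ℕ) : Prop :=
  ∃ ρ p, key m ρ < key m τ ∧ HasSig m f ρ p ∧ p ≠ 0 ∧ m.degree p = e

/-- `p` has signature `τ` and is regularly reduced with respect to all polynomials: its leading
monomial does not occur at a smaller signature. -/
structure IsSigReduced (m : MonomialOrder (Fin n)) (f : Fin r → MvPolynomial (Fin n) K)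
    (τ : Signature n r) (p : MvPolynomial (Fin n) K) : Prop where
  hasSig : HasSig m f τ p
  ne_zero : p ≠ 0
  not_sigLM : ¬ SigLM m f τ (m.degree p)

lemma SigPoly.IsValid.hasSig (h : α.IsValid m f) : HasSig m f α.sig α.poly := ⟨_, h⟩

lemma SigPoly.IsValid.hasSig_monomial_mul (h : α.IsValid m f) (a : Fin n →₀ ℕ) :
    HasSig m f (Signature.mul a α.sig) (monomial a 1 * α.poly) :=
  (h.termMul one_ne_zero).hasSig

lemma exists_hasSig_of_mem_span_image {s : Set (Fin r)} (hp : p ∈ Ideal.span (f '' s))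
    (h0 : p ≠ 0) : ∃ ρ : Signature n r, ρ.1 ∈ s ∧ HasSig m f ρ p := by
  obtain ⟨l, hl, rfl⟩ := (Finsupp.mem_span_image_iff_linearCombination _).1 hp
  have hne : l.support.Nonempty := by
    rw [Finsupp.support_nonempty_iff]
    rintro rfl
    exact h0 (map_zero _)
  set i := l.support.max' hne
  have hi_mem : i ∈ l.support := l.support.max'_mem hne
  refine ⟨(i, m.degree (l i)), hl hi_mem, l i, Finsupp.mem_support_iff.1 hi_mem, rfl, ?_⟩
  rw [Finsupp.linearCombination_apply, Finsupp.sum, ← Finset.add_sum_erase _ _ hi_mem,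
    smul_eq_mul, add_sub_cancel_left]
  refine sum_mem fun j hj => Ideal.mul_mem_left _ _ (mem_idealBelow ?_)
  obtain ⟨hji, hj⟩ := Finset.mem_erase.1 hj
  exact lt_of_le_of_ne (l.support.le_max' j hj) hji

lemma HasSig.exists_sub_hasSig (h : HasSig m f τ p) (h' : HasSig m f τ p') :
    ∃ c : K, p - C c * p' ≠ 0 → ∃ ρ, key m ρ < key m τ ∧ HasSig m f ρ (p - C c * p') := by
  obtain ⟨q, hq⟩ := h
  obtain ⟨q', hq'⟩ := h'
  have hdeg : m.degree q' = m.degree q := hq'.degree_quo.trans hq.degree_quo.symm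
  obtain ⟨c, hc⟩ : ∃ c : K, ltQuot m q q' = C c := ⟨_, by rw [ltQuot, hdeg, tsub_self]; rfl⟩
  have hmem : p - C c * p' - (q - C c * q') * f τ.1 ∈ idealBelow f τ.1 := by
    convert sub_mem hq.sub_mul_mem (Ideal.mul_mem_left _ (C c) hq'.sub_mul_mem) using 1
    ring
  refine ⟨c, fun hne => ?_⟩
  by_cases hquo : q - C c * q' = 0
  · rw [hquo, zero_mul, sub_zero] at hmem
    obtain ⟨ρ, hρ, hp⟩ := exists_hasSig_of_mem_span_image hmem hne
    exact ⟨ρ, Signature.key_lt_key_of_fst_lt hρ, hp⟩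
  · have hlt := degree_sub_ltQuot_mul_lt hq'.quo_ne_zero hdeg.le (by rwa [hc])
    rw [hc, hq.degree_quo] at hlt
    exact ⟨(τ.1, m.degree (q - C c * q')), Signature.lt_iff_key_lt.1 (.inr ⟨rfl, hlt⟩),
      _, hquo, rfl, hmem⟩

lemma IsSigReduced.ne_zero_of_hasSig (h : IsSigReduced m f τ p) (h' : HasSig m f τ p') :
    p' ≠ 0 := by
  rintro rfl
  obtain ⟨c, hc⟩ := h.hasSig.exists_sub_hasSig h'
  rw [mul_zero, sub_zero] at hc
  obtain ⟨ρ, hρ, hp⟩ := hc h.ne_zero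
  exact h.not_sigLM ⟨ρ, p, hρ, hp, h.ne_zero, rfl⟩

lemma IsSigReduced.degree_le (h : IsSigReduced m f τ p) (h' : HasSig m f τ p') :
    m.degree p ≼[m] m.degree p' := by
  by_contra! hlt
  obtain ⟨c, hc⟩ := h.hasSig.exists_sub_hasSig h'
  have hlt' : m.degree (C c * p') ≺[m] m.degree p := by
    refine (m.degree_mul_le.trans ?_).trans_lt hlt
    simp
  obtain ⟨hne, hdeg⟩ := sub_ne_zero_and_degree_sub_of_lt hlt'
  obtain ⟨ρ, hρ, hp⟩ := hc hne
  exact h.not_sigLM ⟨ρ, _, hρ, hp, hne, hdeg⟩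

lemma IsSigReduced.degree_eq (h : IsSigReduced m f τ p) (h' : IsSigReduced m f τ p') :
    m.degree p = m.degree p' :=
  m.toSyn.injective ((h.degree_le h'.hasSig).antisymm (h'.degree_le h.hasSig))

lemma HasSig.exists_isSigReduced (h : HasSig m f σ p) (h0 : p ≠ 0) :
    ∃ ρ p', key m ρ ≤ key m σ ∧ IsSigReduced m f ρ p' ∧ m.degree p' = m.degree p := by
  obtain ⟨ρ, ⟨p', hp', h0', hdeg⟩, hmin⟩ := exists_minimalFor_of_wellFoundedLT
    (fun ρ => ∃ p', HasSig m f ρ p' ∧ p' ≠ 0 ∧ m.degree p' = m.degree p) (key m) ⟨σ, p, h, h0, rfl⟩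
  have hle : ∀ ρ' p', HasSig m f ρ' p' → p' ≠ 0 → m.degree p' = m.degree p →
      key m ρ ≤ key m ρ' := fun ρ' p' h1 h2 h3 =>
    (le_total _ _).elim id (hmin ⟨p', h1, h2, h3⟩)
  refine ⟨ρ, p', hle σ p h h0 rfl, ⟨hp', h0', ?_⟩, hdeg⟩
  rintro ⟨ρ', p'', hlt, hp'', h0'', hdeg'⟩
  exact hlt.not_ge (hle ρ' p'' hp'' h0'' (hdeg'.trans hdeg))

lemma SigLM.exists_isSigReduced (h : SigLM m f σ e) :
    ∃ ρ p, key m ρ < key m σ ∧ IsSigReduced m f ρ p ∧ m.degree p = e := by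
  obtain ⟨τ, p, hτ, hp, h0, rfl⟩ := h
  obtain ⟨ρ, p', hρ, hp', hdeg⟩ := hp.exists_isSigReduced h0
  exact ⟨ρ, p', hρ.trans_lt hτ, hp', hdeg⟩

end Representations

section Rewriters

variable {K : Type*} [Field K] {n r : ℕ} {m : MonomialOrder (Fin n)}
  {f : Fin r → MvPolynomial (Fin n) K} {p q : MvPolynomial (Fin n) K} {ρ σ τ : Signature n r}
  {G : List (SigPoly K n r)} {α β : SigPoly K n r} {k l : ℕ} {a b : Fin n →₀ ℕ}

lemma cofactor_add_degree :
    cofactor m p q + m.degree p = cofactor m q p + m.degree q := by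
  rw [cofactor, cofactor, tsub_add_cancel_of_le le_sup_left, tsub_add_cancel_of_le le_sup_left,
    sup_comm]

lemma exists_add_cofactor (h : a + m.degree p = b + m.degree q) :
    ∃ c, a = c + cofactor m p q ∧ b = c + cofactor m q p := by
  have hle : m.degree p ⊔ m.degree q ≤ a + m.degree p := sup_le le_add_self (h ▸ le_add_self)
  have hp : cofactor m p q + m.degree p = m.degree p ⊔ m.degree q :=
    tsub_add_cancel_of_le le_sup_left
  refine ⟨a + m.degree p - (m.degree p ⊔ m.degree q), add_right_cancel (b := m.degree p) ?_,
    add_right_cancel (b := m.degree q) ?_⟩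
  · rw [add_assoc, hp, tsub_add_cancel_of_le hle]
  · rw [add_assoc, ← cofactor_add_degree, hp, tsub_add_cancel_of_le hle, h]

/-- The signature of the multiple of `α` that occurs in the S-pair of `α` and `β`. -/
noncomputable def cofactorSig (m : MonomialOrder (Fin n)) (α β : SigPoly K n r) : Signature n r :=
  Signature.mul (cofactor m α.poly β.poly) α.sig

lemma sPair_sig :
    (sPair m α β).sig = Signature.max m (cofactorSig m α β) (cofactorSig m β α) := by
  unfold sPair
  split_ifs
  exacts [Signature.max_comm, rfl]

lemma sPair_sig_comm : (sPair m α β).sig = (sPair m β α).sig := by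
  rw [sPair_sig, sPair_sig, Signature.max_comm]

lemma sPair_sig_of_lt (h : key m (cofactorSig m β α) < key m (cofactorSig m α β)) :
    (sPair m α β).sig = cofactorSig m α β :=
  sPair_sig.trans (Signature.max_of_key_gt h)

/-- `α`, at position `k`, is the canonical rewriter of `τ`: the entry of `G` that was added last
among those whose signature divides `τ`. -/
structure IsCanonicalRewriter (G : List (SigPoly K n r)) (k : ℕ) (α : SigPoly K n r)
    (τ : Signature n r) : Prop where
  getElem?_eq : G[k]? = some α
  divides : Signature.divides α.sig τ
  not_divides ⦃j : ℕ⦄ ⦃δ : SigPoly K n r⦄ (hj : k < j) (hδ : G[j]? = some δ) :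
    ¬ Signature.divides δ.sig τ

lemma IsCanonicalRewriter.mem (h : IsCanonicalRewriter G k α τ) : α ∈ G :=
  List.mem_of_getElem? h.getElem?_eq

lemma exists_isCanonicalRewriter (h : ∃ δ ∈ G, Signature.divides δ.sig τ) :
    ∃ k α, IsCanonicalRewriter G k α τ := by
  have hfin : {k | ∃ α : SigPoly K n r, G[k]? = some α ∧ Signature.divides α.sig τ}.Finite :=
    (Set.finite_Iio G.length).subset fun k ⟨_, hα, _⟩ => (List.getElem?_eq_some_iff.1 hα).1
  obtain ⟨δ, hδ, hdvd⟩ := h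
  obtain ⟨j, hj⟩ := List.mem_iff_getElem?.1 hδ
  obtain ⟨k, ⟨α, hα, hdvd⟩, hmax⟩ := hfin.exists_maximal ⟨j, δ, hj, hdvd⟩
  exact ⟨k, α, hα, hdvd, fun i γ hi hγ hdvd => hi.not_ge (hmax ⟨γ, hγ, hdvd⟩ hi.le)⟩

/-- The syzygy or the Koszul criterion, applied with an element of `G`, shows that `τ` is the
signature of a syzygy. -/
def DetectsSyzygy (m : MonomialOrder (Fin n)) (G : List (SigPoly K n r)) (τ : Signature n r) :
    Prop :=
  (∃ δ ∈ G, δ.poly = 0 ∧ Signature.divides δ.sig τ) ∨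
    ∃ δ ∈ G, δ.ind < τ.1 ∧ δ.poly ≠ 0 ∧ m.degree δ.poly ≤ τ.2

lemma DetectsSyzygy.of_divides (h : DetectsSyzygy m G σ) (hdvd : Signature.divides σ τ) :
    DetectsSyzygy m G τ := by
  obtain ⟨hind, hle⟩ := Signature.divides_iff.1 hdvd
  rcases h with ⟨δ, hδ, h0, hδσ⟩ | ⟨δ, hδ, hlt, h0, hdeg⟩
  · exact .inl ⟨δ, hδ, h0, hδσ.trans hdvd⟩
  · exact .inr ⟨δ, hδ, hind ▸ hlt, h0, hdeg.trans hle⟩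

lemma DetectsSyzygy.hasSig_zero (h : DetectsSyzygy m G τ) (hG : ∀ δ ∈ G, δ.IsValid m f) :
    HasSig m f τ 0 := by
  rcases h with ⟨δ, hδ, h0, a, rfl⟩ | ⟨δ, hδ, hlt, h0, hdeg⟩
  · simpa only [h0, mul_zero] using (hG δ hδ).hasSig_monomial_mul a
  · -- the Koszul syzygy of `δ.poly` and `f τ.1`
    refine ⟨monomial (τ.2 - m.degree δ.poly) 1 * δ.poly, mul_ne_zero (by simp) h0, ?_, ?_⟩
    · rw [degree_monomial_mul one_ne_zero h0, tsub_add_cancel_of_le hdeg]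
    · rw [zero_sub, neg_mem_iff]
      exact Ideal.mul_mem_right _ _ (Ideal.mul_mem_left _ _ ((hG δ hδ).mem_idealBelow hlt))

lemma IsSigReduced.not_detectsSyzygy (h : IsSigReduced m f τ p) (hG : ∀ δ ∈ G, δ.IsValid m f) :
    ¬ DetectsSyzygy m G τ :=
  fun hs => h.ne_zero_of_hasSig (hs.hasSig_zero hG) rfl

lemma IsCanonicalRewriter.detectsSyzygy_of_rewritable (h : IsCanonicalRewriter G k α τ)
    (hG : ∀ δ ∈ G, δ.IsValid m f) (hdvd : Signature.divides (Signature.mul a α.sig) τ)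
    (hrw : Rewritable m G k α a) : DetectsSyzygy m G τ := by
  refine DetectsSyzygy.of_divides ?_ hdvd
  obtain ⟨j, δ, hj, ⟨hδ, hlt⟩ | ⟨hδ, h0⟩ | ⟨hlt, h0, hle⟩⟩ := hrw
  · exact absurd (hδ.trans hdvd) (h.not_divides hlt hj)
  · exact .inl ⟨δ, List.mem_of_getElem? hj, h0, hδ⟩
  · have hα := (hG α h.mem).termMul (a := a) one_ne_zero
    exact .inr ⟨δ, List.mem_of_getElem? hj, hlt, h0, hle.trans_eq hα.degree_quo⟩

/-- `τ` is resolved by `G`: either `G` detects a syzygy of signature `τ`, or the multiple of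
signature `τ` of the canonical rewriter is regularly reduced. -/
def Resolved (m : MonomialOrder (Fin n)) (f : Fin r → MvPolynomial (Fin n) K)
    (G : List (SigPoly K n r)) (τ : Signature n r) : Prop :=
  DetectsSyzygy m G τ ∨ ∃ k α a, IsCanonicalRewriter G k α τ ∧ Signature.mul a α.sig = τ ∧
    IsSigReduced m f τ (monomial a 1 * α.poly)

lemma Resolved.exists_degree_eq (h : Resolved m f G τ) (hG : ∀ δ ∈ G, δ.IsValid m f)
    (hp : IsSigReduced m f τ p) : ∃ k α a, IsCanonicalRewriter G k α τ ∧
      Signature.mul a α.sig = τ ∧ α.poly ≠ 0 ∧ a + m.degree α.poly = m.degree p := by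
  obtain ⟨k, α, a, hα, ha, hred⟩ := h.resolve_left (hp.not_detectsSyzygy hG)
  have h0 : α.poly ≠ 0 := right_ne_zero_of_mul hred.ne_zero
  refine ⟨k, α, a, hα, ha, h0, ?_⟩
  rw [← degree_monomial_mul one_ne_zero h0, hred.degree_eq hp]

/-- The S-pair of the entries `α` and `β`, at positions `k` and `l`, has been treated: one of its
multiples is rewritable, or its signature is that of an entry added after `α` and `β`. -/
def IsTreated (m : MonomialOrder (Fin n)) (G : List (SigPoly K n r)) (k l : ℕ)
    (α β : SigPoly K n r) : Prop :=
  (Rewritable m G k α (cofactor m α.poly β.poly) ∨ Rewritable m G l β (cofactor m β.poly α.poly)) ∨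
    ∃ j γ, k < j ∧ l < j ∧ G[j]? = some γ ∧ γ.sig = (sPair m α β).sig

lemma IsTreated.symm (h : IsTreated m G k l α β) : IsTreated m G l k β α := by
  rcases h with hrw | ⟨j, γ, hk, hl, hγ, hsig⟩
  · exact .inl hrw.symm
  · exact .inr ⟨j, γ, hl, hk, hγ, hsig.trans sPair_sig_comm⟩

/-- `G` consists of extended sig-poly pairs, contains one of signature `(i, 1)` for each `i`, and
its regular S-pairs with signature in the initial segment `C` have been treated. -/
structure IsComplete (m : MonomialOrder (Fin n)) (f : Fin r → MvPolynomial (Fin n) K)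
    (G : List (SigPoly K n r)) (C : LowerSet (Fin r ×ₗ m.syn)) : Prop where
  valid : ∀ δ ∈ G, δ.IsValid m f
  initial (i : Fin r) : ∃ δ ∈ G, δ.sig = (i, 0)
  treated ⦃k l : ℕ⦄ ⦃α β : SigPoly K n r⦄ (hk : G[k]? = some α) (hl : G[l]? = some β)
    (hreg : IsRegularPair m α β) (hC : key m (sPair m α β).sig ∈ C) : IsTreated m G k l α β

namespace IsComplete

variable {C : LowerSet (Fin r ×ₗ m.syn)}

lemma exists_isCanonicalRewriter (h : IsComplete m f G C) (τ : Signature n r) :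
    ∃ k α, IsCanonicalRewriter G k α τ := by
  obtain ⟨δ, hδ, hsig⟩ := h.initial τ.1
  exact SGB.exists_isCanonicalRewriter ⟨δ, hδ, Signature.divides_iff.2 (by simp [hsig])⟩

lemma detectsSyzygy_of_degree_eq (h : IsComplete m f G C) (hτ : key m τ ∈ C)
    (hα : IsCanonicalRewriter G k α τ) (hβ : IsCanonicalRewriter G l β ρ)
    (ha : Signature.mul a α.sig = τ) (hb : Signature.mul b β.sig = ρ) (hlt : key m ρ < key m τ)
    (hα0 : α.poly ≠ 0) (hβ0 : β.poly ≠ 0) (hdeg : a + m.degree α.poly = b + m.degree β.poly) :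
    DetectsSyzygy m G τ ∨ DetectsSyzygy m G ρ := by
  obtain ⟨c, rfl, rfl⟩ := exists_add_cofactor hdeg
  have hα' : Signature.mul c (cofactorSig m α β) = τ := Signature.mul_mul.trans ha
  have hβ' : Signature.mul c (cofactorSig m β α) = ρ := Signature.mul_mul.trans hb
  have hdvdα : Signature.divides (cofactorSig m α β) τ := ⟨c, hα'⟩
  have hdvdβ : Signature.divides (cofactorSig m β α) ρ := ⟨c, hβ'⟩
  rw [← hα', ← hβ', Signature.key_mul_lt_key_mul] at hlt
  have hsig : (sPair m α β).sig = cofactorSig m α β := sPair_sig_of_lt hlt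
  have hreg : IsRegularPair m α β := ⟨hα0, hβ0, fun heq => hlt.ne (congrArg (key m) heq.symm)⟩
  rcases h.treated hα.getElem?_eq hβ.getElem?_eq hreg (hsig ▸ C.lower hdvdα.key_le hτ) with
    (hrw | hrw) | ⟨j, γ, hj, -, hγ, hγsig⟩
  · exact .inl (hα.detectsSyzygy_of_rewritable h.valid hdvdα hrw)
  · exact .inr (hβ.detectsSyzygy_of_rewritable h.valid hdvdβ hrw)
  · exact absurd (hγsig.trans hsig ▸ hdvdα) (hα.not_divides hj hγ)

theorem resolved (h : IsComplete m f G C) (hτ : key m τ ∈ C) : Resolved m f G τ := by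
  induction hkey : key m τ using WellFoundedLT.induction generalizing τ with
  | _ _ ih =>
  subst hkey
  obtain ⟨k, α, hα⟩ := h.exists_isCanonicalRewriter τ
  obtain ⟨a, ha⟩ := hα.divides
  by_cases hα0 : α.poly = 0
  · exact .inl (.inl ⟨α, hα.mem, hα0, hα.divides⟩)
  by_cases hlm : SigLM m f τ (a + m.degree α.poly)
  · obtain ⟨ρ, p, hρ, hp, hdeg⟩ := hlm.exists_isSigReduced
    obtain ⟨l, β, b, hβ, hb, hβ0, hdeg'⟩ :=
      (ih _ hρ (C.lower hρ.le hτ) rfl).exists_degree_eq h.valid hp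
    exact .inl ((h.detectsSyzygy_of_degree_eq hτ hα hβ ha hb hρ hα0 hβ0
      (hdeg.symm.trans hdeg'.symm)).resolve_right (hp.not_detectsSyzygy h.valid))
  · refine .inr ⟨k, α, a, hα, ha, ha ▸ (h.valid α hα.mem).hasSig_monomial_mul a,
      mul_ne_zero (by simp) hα0, ?_⟩
    rwa [degree_monomial_mul one_ne_zero hα0]

lemma exists_reducer (h : IsComplete m f G C) (hp : HasSig m f τ p) (hp0 : p ≠ 0)
    (hτ : key m τ ∈ C) : ∃ β ∈ G, ∃ b, β.poly ≠ 0 ∧ b + m.degree β.poly = m.degree p ∧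
      key m (Signature.mul b β.sig) ≤ key m τ := by
  obtain ⟨ρ, p', hρ, hp', hdeg⟩ := hp.exists_isSigReduced hp0
  obtain ⟨l, β, b, hβ, hb, hβ0, hdeg'⟩ :=
    (h.resolved (C.lower hρ hτ)).exists_degree_eq h.valid hp'
  exact ⟨β, hβ.mem, b, hβ0, hdeg'.trans hdeg, hb.symm ▸ hρ⟩

lemma detectsSyzygy (h : IsComplete m f G C) (hs : HasSig m f τ 0) (hτ : key m τ ∈ C) :
    DetectsSyzygy m G τ := by
  refine (h.resolved hτ).resolve_right ?_
  rintro ⟨k, α, a, -, -, hred⟩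
  exact hred.ne_zero_of_hasSig hs rfl

end IsComplete

end Rewriters

section SPairs

variable {K : Type*} [Field K] {n r : ℕ} {m : MonomialOrder (Fin n)}
  {f : Fin r → MvPolynomial (Fin n) K} {G : List (SigPoly K n r)} {α β γ γ' : SigPoly K n r}
  {b : Fin n →₀ ℕ}

lemma IsRegularPair.symm (h : IsRegularPair m α β) : IsRegularPair m β α :=
  ⟨h.2.1, h.1, h.2.2.symm⟩

lemma IsRegularPair.key_ne (h : IsRegularPair m α β) :
    key m (cofactorSig m α β) ≠ key m (cofactorSig m β α) :=
  Signature.key_injective.ne h.2.2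

namespace SigPoly

lemma IsValid.sPairOrdered (hα : α.IsValid m f) (hβ : β.IsValid m f) (h : IsRegularPair m α β)
    (hle : key m β.sig ≤ key m α.sig) : (sPairOrdered m α β).IsValid m f := by
  have hα' := hα.termMul (a := cofactor m α.poly β.poly)
    (inv_ne_zero (m.leadingCoeff_ne_zero_iff.2 h.1))
  have hβ' := hβ.termMul (a := cofactor m β.poly α.poly)
    (inv_ne_zero (m.leadingCoeff_ne_zero_iff.2 h.2.1))
  have hind : β.ind ≤ α.ind := Signature.fst_le_of_key_le hle
  have hsig : Signature.max m (Signature.mul (cofactor m α.poly β.poly) α.sig)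
      (Signature.mul (cofactor m β.poly α.poly) β.sig) =
        Signature.max m (cofactorSig m α β) (cofactorSig m β α) := rfl
  rcases h.key_ne.lt_or_gt with hlt | hlt
  · have hind' : α.ind = β.ind :=
      (Signature.fst_le_of_key_le (σ := cofactorSig m α β) hlt.le).antisymm hind
    rw [SGB.sPairOrdered, hsig, Signature.max_of_key_lt hlt, if_neg hind'.not_gt]
    have hneg := (hβ'.sub_of_ind_eq hα' hind' hlt).neg
    rwa [neg_sub, neg_sub] at hneg
  · rw [SGB.sPairOrdered, hsig, Signature.max_of_key_gt hlt]
    split_ifs with hlt'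
    · exact hα'.sub_of_ind_lt hβ' hlt'
    · exact hα'.sub_of_ind_eq hβ' (hind.eq_of_not_lt hlt') hlt

lemma IsValid.sPair (hα : α.IsValid m f) (hβ : β.IsValid m f) (h : IsRegularPair m α β) :
    (sPair m α β).IsValid m f := by
  unfold SGB.sPair
  split_ifs with hlt
  · exact hβ.sPairOrdered hα h.symm (Signature.lt_iff_key_lt.1 hlt).le
  · exact hα.sPairOrdered hβ h (not_lt.1 (Signature.lt_iff_key_lt.not.1 hlt))

lemma IsValid.sigLM_cofactorSig (hβ : β.IsValid m f) (hβ0 : β.poly ≠ 0)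
    (hlt : key m (cofactorSig m β α) < key m (cofactorSig m α β)) :
    SigLM m f (cofactorSig m α β) (cofactor m α.poly β.poly + m.degree α.poly) := by
  refine ⟨_, _, hlt, hβ.hasSig_monomial_mul _, mul_ne_zero (by simp) hβ0, ?_⟩
  rw [degree_monomial_mul one_ne_zero hβ0, cofactor_add_degree]

end SigPoly

namespace RegRedStep

lemma isValid (h : RegRedStep m G γ γ') (hG : ∀ δ ∈ G, δ.IsValid m f) (hγ : γ.IsValid m f) :
    γ'.IsValid m f := by
  obtain ⟨poly, sig, quo⟩ := γ'
  obtain ⟨β, hβ, h0, hβ0, -, hlt, rfl, rfl, hquo, hquo'⟩ := h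
  rw [Signature.lt_iff_key_lt] at hlt
  have hβ' := (hG β hβ).termMul (a := m.degree γ.poly - m.degree β.poly)
    (div_ne_zero (m.leadingCoeff_ne_zero_iff.2 h0) (m.leadingCoeff_ne_zero_iff.2 hβ0))
  by_cases hind : β.ind = γ.ind
  · obtain rfl := hquo hind
    exact hγ.sub_of_ind_eq hβ' hind hlt
  · obtain rfl := hquo' hind
    exact hγ.sub_of_ind_lt hβ' ((Signature.fst_le_of_key_le hlt.le).lt_of_ne hind)

lemma sig_eq (h : RegRedStep m G γ γ') : γ'.sig = γ.sig := by
  obtain ⟨β, -, -, -, -, -, -, hsig, -⟩ := h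
  exact hsig

lemma withBotDegree_lt (h : RegRedStep m G γ γ') :
    m.toWithBotSyn (m.withBotDegree γ'.poly) < m.toWithBotSyn (m.withBotDegree γ.poly) := by
  obtain ⟨β, -, h0, hβ0, hle, -, hpoly, -⟩ := h
  rw [m.withBotDegree_lt_withBotDegree_iff, or_iff_not_imp_right, hpoly]
  exact fun hne => degree_sub_ltQuot_mul_lt hβ0 hle fun heq => hne ⟨heq, h0⟩

end RegRedStep

lemma exists_regRedStep (hβ : β ∈ G) (h0 : γ.poly ≠ 0) (hβ0 : β.poly ≠ 0)
    (hb : b + m.degree β.poly = m.degree γ.poly)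
    (hlt : key m (Signature.mul b β.sig) < key m γ.sig) : ∃ γ', RegRedStep m G γ γ' := by
  classical
  have hb' : m.degree γ.poly - m.degree β.poly = b := by rw [← hb, add_tsub_cancel_right]
  refine ⟨⟨γ.poly - ltQuot m γ.poly β.poly * β.poly, γ.sig,
    if β.ind = γ.ind then γ.quo - ltQuot m γ.poly β.poly * β.quo else γ.quo⟩, β, hβ, h0, hβ0,
    hb ▸ le_add_self, ?_, rfl, rfl, fun h => if_pos h, fun h => if_neg h⟩
  rwa [hb', Signature.lt_iff_key_lt]

end SPairs

section Invariant

variable {K : Type*} [Field K] {n r : ℕ} {m : MonomialOrder (Fin n)}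
  {f : Fin r → MvPolynomial (Fin n) K} {G G' : List (SigPoly K n r)} {v : Vars K n r}
  {α β γ : SigPoly K n r} {k l : ℕ} {a : Fin n →₀ ℕ} {i : Fin r} {s s' : State K n r}

lemma getElem?_append_of_eq_some {X : Type*} {L L' : List X} {x : X} (h : L[k]? = some x) :
    (L ++ L')[k]? = some x := by
  rwa [List.getElem?_append_left (List.getElem?_eq_some_iff.1 h).1]

lemma getElem?_append_singleton {X : Type*} {L : List X} {x y : X}
    (h : (L ++ [y])[k]? = some x) : L[k]? = some x ∨ k = L.length ∧ x = y := by
  grind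

lemma Rewritable.append (h : Rewritable m G k α a) : Rewritable m (G ++ G') k α a := by
  obtain ⟨j, δ, hj, h⟩ := h
  exact ⟨j, δ, getElem?_append_of_eq_some hj, h⟩

lemma IsTreated.append (h : IsTreated m G k l α β) : IsTreated m (G ++ G') k l α β := by
  rcases h with hrw | ⟨j, γ, hk, hl, hγ, hsig⟩
  · exact .inl (hrw.imp Rewritable.append Rewritable.append)
  · exact .inr ⟨j, γ, hk, hl, getElem?_append_of_eq_some hγ, hsig⟩

lemma regularPairs_subset_append : regularPairs m G ⊆ regularPairs m (G ++ G') :=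
  fun _ ⟨hlt, α, β, hα, hβ, hreg⟩ =>
    ⟨hlt, α, β, getElem?_append_of_eq_some hα, getElem?_append_of_eq_some hβ, hreg⟩

/-- The quotients of index `i` that the algorithm records: those of the elements of `G` with zero
polynomial part, except for the `r` initial elements. -/
def recordedQuos (G : List (SigPoly K n r)) (i : Fin r) : Set (MvPolynomial (Fin n) K) :=
  {q | ∃ δ ∈ G.drop r, δ.poly = 0 ∧ δ.ind = i ∧ δ.quo = q}

lemma recordedQuos_append (hr : r ≤ G.length) :
    recordedQuos (G ++ [γ]) i = recordedQuos G i ∪ {q | γ.poly = 0 ∧ γ.ind = i ∧ γ.quo = q} := by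
  ext q
  simp [recordedQuos, List.drop_append_of_le_length hr, or_and_right, exists_or]

/-- The invariant of the main loop. -/
structure Inv (m : MonomialOrder (Fin n)) (f : Fin r → MvPolynomial (Fin n) K)
    (v : Vars K n r) : Prop where
  valid : ∀ δ ∈ v.G, δ.IsValid m f
  initial (i : Fin r) : v.G[i.val]? = some ⟨f i, (i, 0), 1⟩
  length_le : r ≤ v.G.length
  pairs_subset : v.P ⊆ regularPairs m v.G
  treated ⦃k l : ℕ⦄ ⦃α β : SigPoly K n r⦄ (hlk : l < k) (hk : v.G[k]? = some α)
    (hl : v.G[l]? = some β) (hreg : IsRegularPair m α β) :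
    (k, l) ∈ v.P ∨ IsTreated m v.G k l α β
  quos_eq (i : Fin r) : v.S i = recordedQuos v.G i

lemma inv_init : Inv m f { G := initG f, P := regularPairs m (initG f), S := fun _ => ∅ } where
  valid δ hδ := by
    obtain ⟨i, rfl⟩ := List.mem_ofFn.1 hδ
    exact ⟨one_ne_zero, m.degree_one, by simp⟩
  initial i := by simp [initG]
  length_le := by simp [initG]
  pairs_subset := subset_rfl
  treated _ _ α β hlk hk hl hreg := .inl ⟨hlk, α, β, hk, hl, hreg⟩
  quos_eq i := by simp [recordedQuos, List.drop_of_length_le, initG]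

namespace Inv

lemma finite_pairs (h : Inv m f v) : v.P.Finite := by
  refine ((Set.finite_Iio v.G.length).prod (Set.finite_Iio v.G.length)).subset fun p hp => ?_
  obtain ⟨-, α, β, hα, hβ, -⟩ := h.pairs_subset hp
  exact ⟨(List.getElem?_eq_some_iff.1 hα).1, (List.getElem?_eq_some_iff.1 hβ).1⟩

lemma isRegularPair (h : Inv m f v) (hP : (k, l) ∈ v.P) (hk : v.G[k]? = some α)
    (hl : v.G[l]? = some β) : IsRegularPair m α β := by
  obtain ⟨-, α', β', hk', hl', hreg⟩ := h.pairs_subset hP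
  obtain rfl : α = α' := Option.some_injective _ (hk.symm.trans hk')
  obtain rfl : β = β' := Option.some_injective _ (hl.symm.trans hl')
  exact hreg

lemma isComplete (h : Inv m f v) {C : LowerSet (Fin r ×ₗ m.syn)}
    (hP : ∀ ⦃k l α β⦄, (k, l) ∈ v.P → v.G[k]? = some α → v.G[l]? = some β →
      key m (sPair m α β).sig ∉ C) : IsComplete m f v.G C where
  valid := h.valid
  initial i := ⟨_, List.mem_of_getElem? (h.initial i), rfl⟩
  treated k l α β hk hl hreg hC := by
    rcases lt_trichotomy l k with hlk | rfl | hkl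
    · exact (h.treated hlk hk hl hreg).resolve_left fun hmem => hP hmem hk hl hC
    · obtain rfl : α = β := Option.some_injective _ (hk.symm.trans hl)
      exact absurd rfl hreg.2.2
    · rw [sPair_sig_comm] at hC
      exact ((h.treated hkl hl hk hreg.symm).resolve_left fun hmem => hP hmem hl hk hC).symm

lemma erase (h : Inv m f v) (hk : v.G[k]? = some α) (hl : v.G[l]? = some β)
    (ht : IsTreated m v.G k l α β) : Inv m f { v with P := v.P \ {(k, l)} } where
  __ := h
  pairs_subset := Set.sdiff_subset.trans h.pairs_subset
  treated k' l' α' β' hlk hk' hl' hreg := by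
    by_cases heq : (k', l') = (k, l)
    · obtain ⟨rfl, rfl⟩ := Prod.mk.inj heq
      obtain rfl : α = α' := Option.some_injective _ (hk.symm.trans hk')
      obtain rfl : β = β' := Option.some_injective _ (hl.symm.trans hl')
      exact .inr ht
    · exact (h.treated hlk hk' hl' hreg).imp_left fun hmem => ⟨hmem, heq⟩

lemma append (h : Inv m f v) (hγ : γ.IsValid m f) :
    Inv m f
      { G := v.G ++ [γ]
        P := v.P ∪ {p | p ∈ regularPairs m (v.G ++ [γ]) ∧ p.1 = v.G.length}
        S := fun i => v.S i ∪ {q | γ.poly = 0 ∧ γ.ind = i ∧ γ.quo = q} } where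
  valid δ hδ := by
    rcases List.mem_append.1 hδ with hδ | hδ
    · exact h.valid δ hδ
    · rwa [List.mem_singleton.1 hδ]
  initial i := getElem?_append_of_eq_some (h.initial i)
  length_le := h.length_le.trans (by simp)
  pairs_subset :=
    Set.union_subset (h.pairs_subset.trans regularPairs_subset_append) fun _ hp => hp.1
  treated k l α β hlk hk hl hreg := by
    rcases getElem?_append_singleton hk with hk' | ⟨hklen, -⟩
    · have hlt : l < v.G.length := hlk.trans (List.getElem?_eq_some_iff.1 hk').1
      have hl' : v.G[l]? = some β :=
        (getElem?_append_singleton hl).resolve_right fun hlen => hlt.ne hlen.1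
      exact (h.treated hlk hk' hl' hreg).imp .inl IsTreated.append
    · exact .inl (.inr ⟨⟨hlk, α, β, hk, hl, hreg⟩, hklen⟩)
  quos_eq i := by simp only [h.quos_eq, recordedQuos_append h.length_le]

end Inv

/-- The invariant of the regular reduction: the S-pair of `α` and `β`, at positions `k` and `l`, has
been selected in the main loop with variables `v`, and `γ` is its current remainder. -/
structure Reducing (m : MonomialOrder (Fin n)) (f : Fin r → MvPolynomial (Fin n) K)
    (v : Vars K n r) (k l : ℕ) (α β γ : SigPoly K n r) : Prop where
  inv : Inv m f v
  isMinimalPair : IsMinimalPair m v k l α β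
  not_pairRewritable : ¬ PairRewritable m v k l α β
  valid : γ.IsValid m f
  sig_eq : γ.sig = (sPair m α β).sig

/-- What holds at the moment when `γ` is added to the list `G`: its signature is not divisible by
that of an element of `G` with zero polynomial part, `γ` is regularly reduced, and its signature is
that of a multiple of its parent, a canonical rewriter; this multiple is not regularly reduced. -/
structure InsertedAfter (m : MonomialOrder (Fin n)) (f : Fin r → MvPolynomial (Fin n) K)
    (G : List (SigPoly K n r)) (γ : SigPoly K n r) : Prop where
  not_divides : ∀ δ ∈ G, δ.poly = 0 → ¬ Signature.divides δ.sig γ.sig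
  exists_parent : ∃ k α a, IsCanonicalRewriter G k α γ.sig ∧ Signature.mul a α.sig = γ.sig ∧
    α.poly ≠ 0 ∧ SigLM m f γ.sig (a + m.degree α.poly)
  not_sigLM : γ.poly ≠ 0 → ¬ SigLM m f γ.sig (m.degree γ.poly)

namespace Reducing

lemma isComplete (h : Reducing m f v k l α β γ) :
    IsComplete m f v.G (LowerSet.Iio (key m γ.sig)) := by
  refine h.inv.isComplete fun k' l' α' β' hP hk hl hlt => ?_
  rw [h.sig_eq, LowerSet.mem_Iio_iff, ← Signature.lt_iff_key_lt] at hlt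
  exact h.isMinimalPair.2.2.2 k' l' α' β' hP hk hl hlt

lemma exists_parent (h : Reducing m f v k l α β γ) :
    ∃ j δ a, v.G[j]? = some δ ∧ Signature.mul a δ.sig = γ.sig ∧ ¬ Rewritable m v.G j δ a ∧
      δ.poly ≠ 0 ∧ SigLM m f γ.sig (a + m.degree δ.poly) := by
  obtain ⟨hP, hk, hl, -⟩ := h.isMinimalPair
  have hreg : IsRegularPair m α β := h.inv.isRegularPair hP hk hl
  obtain ⟨hrwα, hrwβ⟩ := not_or.1 h.not_pairRewritable
  rw [h.sig_eq]
  rcases hreg.key_ne.lt_or_gt with hlt | hlt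
  · rw [sPair_sig_comm, sPair_sig_of_lt hlt]
    have hα := h.inv.valid α (List.mem_of_getElem? hk)
    exact ⟨l, β, _, hl, rfl, hrwβ, hreg.2.1, hα.sigLM_cofactorSig hreg.1 hlt⟩
  · rw [sPair_sig_of_lt hlt]
    have hβ := h.inv.valid β (List.mem_of_getElem? hl)
    exact ⟨k, α, _, hk, rfl, hrwα, hreg.1, hβ.sigLM_cofactorSig hreg.2.1 hlt⟩

lemma not_sigLM (h : Reducing m f v k l α β γ) (hirr : ∀ γ', ¬ RegRedStep m v.G γ γ')
    (h0 : γ.poly ≠ 0) : ¬ SigLM m f γ.sig (m.degree γ.poly) := by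
  rintro ⟨ρ, p, hρ, hp, hp0, hdeg⟩
  obtain ⟨β, hβ, b, hβ0, hb, hle⟩ := h.isComplete.exists_reducer hp hp0 hρ
  obtain ⟨γ', hγ'⟩ := exists_regRedStep hβ h0 hβ0 (hb.trans hdeg) (hle.trans_lt hρ)
  exact hirr γ' hγ'

lemma insertedAfter (h : Reducing m f v k l α β γ) (hirr : ∀ γ', ¬ RegRedStep m v.G γ γ') :
    InsertedAfter m f v.G γ := by
  obtain ⟨j, δ, a, hj, hsig, hrw, h0, hlm⟩ := h.exists_parent
  have hdvd : Signature.divides δ.sig γ.sig := ⟨a, hsig⟩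
  refine ⟨fun ε hε hε0 hdvd' => ?_, ⟨j, δ, a, ⟨hj, hdvd, fun i ε hi hε hdvd' => ?_⟩, hsig, h0, hlm⟩,
    h.not_sigLM hirr⟩
  · obtain ⟨i, hi⟩ := List.mem_iff_getElem?.1 hε
    exact hrw ⟨i, ε, hi, .inr (.inl ⟨hsig ▸ hdvd', hε0⟩)⟩
  · exact hrw ⟨i, ε, hε, .inl ⟨hsig ▸ hdvd', hi⟩⟩

lemma inv_append (h : Reducing m f v k l α β γ) :
    Inv m f
      { G := v.G ++ [γ]
        P := v.P \ {(k, l)} ∪ {p | p ∈ regularPairs m (v.G ++ [γ]) ∧ p.1 = v.G.length}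
        S := fun i => v.S i ∪ {q | γ.poly = 0 ∧ γ.ind = i ∧ γ.quo = q} } := by
  obtain ⟨-, hk, hl, -⟩ := h.isMinimalPair
  have hklen : k < v.G.length := (List.getElem?_eq_some_iff.1 hk).1
  have hllen : l < v.G.length := (List.getElem?_eq_some_iff.1 hl).1
  have ht : IsTreated m (v.G ++ [γ]) k l α β :=
    .inr ⟨v.G.length, γ, hklen, hllen, List.getElem?_concat_length, h.sig_eq⟩
  convert (h.inv.append h.valid).erase (getElem?_append_of_eq_some hk)
    (getElem?_append_of_eq_some hl) ht using 2
  have hnotMem : (k, l) ∉ {p | p ∈ regularPairs m (v.G ++ [γ]) ∧ p.1 = v.G.length} :=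
    fun hmem => hklen.ne hmem.2
  rw [Set.union_sdiff_distrib, Set.sdiff_singleton_eq_self hnotMem]

end Reducing

/-- The invariant of the algorithm. -/
def StateInv (m : MonomialOrder (Fin n)) (f : Fin r → MvPolynomial (Fin n) K) :
    State K n r → Prop
  | .main v => Inv m f v
  | .reducing v γ => ∃ v₀ k l α β, v = { v₀ with P := v₀.P \ {(k, l)} } ∧
      Reducing m f v₀ k l α β γ

lemma setOf_regularPairs_append_eq_empty (h0 : γ.poly = 0) :
    {p | p ∈ regularPairs m (G ++ [γ]) ∧ p.1 = G.length} = ∅ := by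
  refine Set.eq_empty_of_forall_notMem ?_
  rintro ⟨k, l⟩ ⟨⟨-, α, β, hk, -, hα0, -⟩, rfl⟩
  obtain rfl : γ = α := Option.some_injective _ (List.getElem?_concat_length.symm.trans hk)
  exact hα0 h0

lemma StateInv.step (h : StateInv m f s) (hs : Step m s s') : StateInv m f s' := by
  cases hs with
  | discard v k l α β hmin hrw => exact Inv.erase h hmin.2.1 hmin.2.2.1 (.inl hrw)
  | select v k l α β hmin hrw =>
    have hv : Inv m f v := h
    obtain ⟨hP, hk, hl, -⟩ := id hmin
    have hvalid := (hv.valid α (List.mem_of_getElem? hk)).sPair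
      (hv.valid β (List.mem_of_getElem? hl)) (hv.isRegularPair hP hk hl)
    exact ⟨v, k, l, α, β, rfl, hv, hmin, hrw, hvalid, rfl⟩
  | reduce v γ γ' hred =>
    obtain ⟨v, k, l, α, β, rfl, hR⟩ := h
    exact ⟨v, k, l, α, β, rfl, { hR with
      valid := hred.isValid hR.inv.valid hR.valid
      sig_eq := hred.sig_eq.trans hR.sig_eq }⟩
  | insert v γ hirr hγ =>
    obtain ⟨v, k, l, α, β, rfl, hR⟩ := h
    simpa [StateInv, hγ] using hR.inv_append
  | record v γ hγ =>
    obtain ⟨v, k, l, α, β, rfl, hR⟩ := h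
    have hS : Function.update v.S γ.ind (v.S γ.ind ∪ {γ.quo}) =
        fun i => v.S i ∪ {q | γ.poly = 0 ∧ γ.ind = i ∧ γ.quo = q} := by
      ext i q
      by_cases hi : i = γ.ind
      · subst hi
        simp [hγ, eq_comm]
      · simp [hi, Ne.symm hi]
    simpa only [StateInv, hS, setOf_regularPairs_append_eq_empty hγ, Set.union_empty] using
      hR.inv_append

lemma Reachable.stateInv (h : Reachable m f s) : StateInv m f s := by
  induction h with
  | refl => exact inv_init
  | tail _ hs ih => exact ih.step hs

end Invariant

section Sequences

variable {X Y : Type*} {rel : X → X → Prop} {x : ℕ → X}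

lemma exists_lt_rel_of_infinite (h : WellQuasiOrdered rel) {A : Set ℕ} (hA : A.Infinite)
    (x : ℕ → X) : ∃ i ∈ A, ∃ j ∈ A, i < j ∧ rel (x i) (x j) := by
  obtain ⟨i, j, hij, hx⟩ := h fun t => x (Nat.nth (· ∈ A) t)
  exact ⟨_, Nat.nth_mem_of_infinite hA i, _, Nat.nth_mem_of_infinite hA j,
    Nat.nth_strictMono hA hij, hx⟩

lemma finite_image_of_eq_of_rel (h : WellQuasiOrdered rel) {A : Set ℕ} {φ : ℕ → Y}
    (hφ : ∀ s ∈ A, ∀ k ∈ A, s < k → rel (x s) (x k) → φ s = φ k) : (φ '' A).Finite := by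
  by_contra hinf
  obtain ⟨B, hBA, hB⟩ := Set.exists_subset_bijOn A φ
  rw [← hB.image_eq] at hinf
  obtain ⟨s, hs, k, hk, hsk, hrel⟩ := exists_lt_rel_of_infinite h (Set.Infinite.of_image φ hinf) x
  exact hsk.ne (hB.injOn hs hk (hφ s (hBA hs) k (hBA hk) hsk hrel))

-- By induction along the finitely many values of `φ`: a fiber consists of children of elements of
-- smaller value.
lemma finite_of_finite_children [Preorder Y] {N B : Set X} {φ : X → Y} {child : X → Set X}
    (hφ : (φ '' N).Finite) (hB : B.Finite) (hchild : ∀ j ∈ N, (child j).Finite)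
    (hN : ∀ k ∈ N, k ∈ B ∨ ∃ j ∈ N, k ∈ child j ∧ φ j < φ k) : N.Finite := by
  refine Set.Finite.of_finite_fibers φ hφ fun y hy => ?_
  refine (hφ.wellFoundedOn (r := (· < ·))).induction (P := fun y => (N ∩ φ ⁻¹' {y}).Finite) hy
    fun y hy ih => ?_
  have hbelow : {j ∈ N | φ j < y}.Finite := by
    refine ((hφ.subset (Set.sep_subset _ (· < y))).biUnion
      fun z hz => ih z hz.1 hz.2).subset fun j hj => ?_
    exact Set.mem_biUnion (x := φ j) ⟨Set.mem_image_of_mem φ hj.1, hj.2⟩ ⟨hj.1, rfl⟩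
  refine (hB.union (hbelow.biUnion fun j hj => hchild j hj.1)).subset ?_
  rintro k ⟨hk, rfl⟩
  refine (hN k hk).imp_right fun ⟨j, hj, hkj, hlt⟩ => ?_
  exact Set.mem_biUnion (x := j) ⟨hj, hlt⟩ hkj

lemma exists_eq_map_range {L : ℕ → List X} (h : ∀ t, ∃ y, L (t + 1) = L t ++ [y]) :
    ∃ x : ℕ → X, ∀ t, L t = (List.range ((L 0).length + t)).map x := by
  choose y hy using h
  refine ⟨fun k => if hk : k < (L 0).length then (L 0)[k] else y (k - (L 0).length), fun t => ?_⟩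
  induction t with
  | zero => exact List.ext_getElem (by simp) fun k hk _ => by simp [hk]
  | succ t ih => rw [hy, ih, ← add_assoc, List.range_succ]; simp

lemma getElem?_map_range {j k : ℕ} {y : X} (h : ((List.range k).map x)[j]? = some y) :
    j < k ∧ x j = y := by
  obtain ⟨hj, rfl⟩ := List.getElem?_eq_some_iff.1 h
  simpa using hj

end Sequences

section Termination

variable {K : Type*} [Field K] {n r : ℕ} {m : MonomialOrder (Fin n)}
  {f : Fin r → MvPolynomial (Fin n) K} {G : List (SigPoly K n r)} {γ δ : SigPoly K n r}
  {a : Fin n →₀ ℕ} {s s' : State K n r} {g : ℕ → SigPoly K n r} {N : ℕ}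

namespace SigPoly

/-- The ratio of the signature of `δ` to its leading monomial, compared by the monomial order. -/
noncomputable def ratio (m : MonomialOrder (Fin n)) (δ : SigPoly K n r) :
    Algebra.GrothendieckAddGroup m.syn :=
  AddLocalization.mk (m.toSyn δ.sig.2) ⟨m.toSyn (m.degree δ.poly), trivial⟩

lemma ratio_eq_of_divides (hδ : δ.IsValid m f) (hδ0 : δ.poly ≠ 0)
    (hγ : IsSigReduced m f γ.sig γ.poly) (hdvd : Signature.divides δ.sig γ.sig)
    (hle : m.degree δ.poly ≤ m.degree γ.poly) : δ.ratio m = γ.ratio m := by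
  obtain ⟨a, ha⟩ := hdvd
  obtain ⟨b, hb⟩ := le_iff_exists_add'.1 hle
  have hba : m.toSyn b ≤ m.toSyn a := by
    have h := hγ.degree_le (ha ▸ hδ.hasSig_monomial_mul a)
    rwa [degree_monomial_mul one_ne_zero hδ0, hb, map_add, map_add, add_le_add_iff_right] at h
  have hab : ¬ m.toSyn b < m.toSyn a := fun hlt => by
    refine hγ.not_sigLM ⟨Signature.mul b δ.sig, _, ?_, hδ.hasSig_monomial_mul b,
      mul_ne_zero (by simp) hδ0, by rw [degree_monomial_mul one_ne_zero hδ0, hb]⟩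
    rw [← ha]
    exact Signature.lt_iff_key_lt.1 (.inr ⟨rfl, by simpa [Signature.mul] using hlt⟩)
  obtain rfl : a = b := m.toSyn.injective (hba.eq_of_not_lt hab).symm
  rw [ratio, ratio, AddLocalization.mk_eq_mk_iff', hb, ← ha, Signature.mul]
  simp only [map_add]
  abel

lemma ratio_lt_of_mul_sig_eq (ha : Signature.mul a δ.sig = γ.sig)
    (hlt : m.degree γ.poly ≺[m] a + m.degree δ.poly) : δ.ratio m < γ.ratio m := by
  rw [ratio, ratio, AddLocalization.mk_lt_mk, ← ha, Signature.mul, ← map_add, ← map_add,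
    add_left_comm, ← add_assoc, map_add, map_add m.toSyn (a + _)]
  exact add_lt_add_left hlt _

end SigPoly

lemma InsertedAfter.isSigReduced (h : InsertedAfter m f G γ) (hγ : γ.IsValid m f)
    (h0 : γ.poly ≠ 0) : IsSigReduced m f γ.sig γ.poly :=
  ⟨hγ.hasSig, h0, h.not_sigLM h0⟩

lemma InsertedAfter.exists_ratio_lt (h : InsertedAfter m f G γ) (hG : ∀ δ ∈ G, δ.IsValid m f)
    (hγ : γ.IsValid m f) (h0 : γ.poly ≠ 0) : ∃ k α, IsCanonicalRewriter G k α γ.sig ∧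
      α.poly ≠ 0 ∧ α.ratio m < γ.ratio m := by
  obtain ⟨k, α, a, hα, ha, hα0, hlm⟩ := h.exists_parent
  have hle := (h.isSigReduced hγ h0).degree_le (ha ▸ (hG α hα.mem).hasSig_monomial_mul a)
  rw [degree_monomial_mul one_ne_zero hα0] at hle
  refine ⟨k, α, hα, hα0, SigPoly.ratio_lt_of_mul_sig_eq ha (hle.lt_of_ne fun heq => ?_)⟩
  exact h.not_sigLM h0 (m.toSyn.injective heq ▸ hlm)

lemma finite_setOf_poly_eq_zero
    (hins : ∀ k, N ≤ k → InsertedAfter m f ((List.range k).map g) (g k)) :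
    {k | N ≤ k ∧ (g k).poly = 0}.Finite := by
  by_contra hinf
  obtain ⟨i, hi, k, hk, hik, hdvd⟩ :=
    exists_lt_rel_of_infinite Signature.wellQuasiOrdered_divides hinf fun k => (g k).sig
  exact (hins k hk.1).not_divides (g i) (List.mem_map_of_mem (List.mem_range.2 hik)) hi.2 hdvd

lemma finite_image_ratio (hg : ∀ k, (g k).IsValid m f)
    (hins : ∀ k, N ≤ k → InsertedAfter m f ((List.range k).map g) (g k)) :
    (SigPoly.ratio m ∘ g '' {k | N ≤ k ∧ (g k).poly ≠ 0}).Finite := by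
  refine finite_image_of_eq_of_rel (x := fun k => ((g k).sig, m.degree (g k).poly))
    (Signature.wellQuasiOrdered_divides.prod wellQuasiOrdered_le) ?_
  rintro s ⟨-, hs⟩ k ⟨hk, hk0⟩ - ⟨hdvd, hle⟩
  exact SigPoly.ratio_eq_of_divides (hg s) hs ((hins k hk).isSigReduced (hg k) hk0) hdvd hle

lemma finite_setOf_poly_ne_zero (hg : ∀ k, (g k).IsValid m f)
    (hins : ∀ k, N ≤ k → InsertedAfter m f ((List.range k).map g) (g k)) :
    {k | (g k).poly ≠ 0}.Finite := by
  refine finite_of_finite_children (φ := SigPoly.ratio m ∘ g) (B := Set.Iio N)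
    (child := fun j => {k | j < k ∧ ∀ i, j < i → i < k → ¬ Signature.divides (g i).sig (g k).sig})
    ?_ (Set.finite_Iio N) (fun j _ => ?_) fun k hk => or_iff_not_imp_left.2 fun hkN => ?_
  · refine (((Set.finite_Iio N).image (SigPoly.ratio m ∘ g)).union
      (finite_image_ratio hg hins)).subset ?_
    rintro _ ⟨k, hk, rfl⟩
    exact (lt_or_ge k N).imp (Set.mem_image_of_mem _) fun hkN => ⟨k, ⟨hkN, hk⟩, rfl⟩
  · by_contra hinf
    obtain ⟨i, hi, k, hk, hik, hdvd⟩ :=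
      exists_lt_rel_of_infinite Signature.wellQuasiOrdered_divides hinf fun k => (g k).sig
    exact hk.2 i hi.1 hik hdvd
  · have hG : ∀ δ ∈ (List.range k).map g, δ.IsValid m f := by
      rintro _ hδ
      obtain ⟨j, -, rfl⟩ := List.mem_map.1 hδ
      exact hg j
    obtain ⟨j, α, hα, hα0, hlt⟩ := (hins k (not_lt.1 hkN)).exists_ratio_lt hG (hg k) hk
    obtain ⟨hjk, rfl⟩ := getElem?_map_range hα.getElem?_eq
    refine ⟨j, hα0, ⟨hjk, fun i hji hik => hα.not_divides hji ?_⟩, hlt⟩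
    simp [List.getElem?_range hik]

/-- `G'` is obtained from `G` by adding an element as the algorithm does. -/
def IsExtension (m : MonomialOrder (Fin n)) (f : Fin r → MvPolynomial (Fin n) K)
    (G' G : List (SigPoly K n r)) : Prop :=
  (∀ δ ∈ G', δ.IsValid m f) ∧ ∃ γ, G' = G ++ [γ] ∧ InsertedAfter m f G γ

lemma wellFounded_isExtension : WellFounded (IsExtension (r := r) m f) := by
  refine wellFounded_iff_isEmpty_descending_chain.2 ⟨fun ⟨L, hL⟩ => ?_⟩
  obtain ⟨g, hg⟩ := exists_eq_map_range fun t => (hL t).2.imp fun _ h => h.1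
  set N := (L 0).length
  have hvalid (k : ℕ) : (g k).IsValid m f := by
    refine (hL k).1 _ ?_
    rw [hg]
    exact List.mem_map_of_mem (List.mem_range.2 (by omega))
  have hins (k : ℕ) (hk : N ≤ k) : InsertedAfter m f ((List.range k).map g) (g k) := by
    obtain ⟨t, rfl⟩ := Nat.exists_eq_add_of_le hk
    obtain ⟨-, γ, hγ, h⟩ := hL t
    obtain rfl : g (N + t) = γ := by simpa [hg, ← add_assoc, List.range_succ] using hγ
    rwa [hg] at h
  refine Set.infinite_univ (((Set.finite_Iio N).union ((finite_setOf_poly_eq_zero hins).union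
    (finite_setOf_poly_ne_zero hvalid hins))).subset fun k _ => ?_)
  refine (lt_or_ge k N).imp_right fun hk => ?_
  exact (eq_or_ne (g k).poly 0).imp_left fun h0 => ⟨hk, h0⟩

/-- The list `G` of a state. -/
def State.list : State K n r → List (SigPoly K n r)
  | .main v => v.G
  | .reducing v _ => v.G

/-- A measure for the steps that keep the list `G`. -/
noncomputable def State.rank (m : MonomialOrder (Fin n)) : State K n r → ℕ ×ₗ WithBot m.syn
  | .main v => toLex (v.P.ncard + 1, ⊥)
  | .reducing _ γ => toLex (0, m.toWithBotSyn (m.withBotDegree γ.poly))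

lemma StateInv.isExtension_or_rank_lt (h : StateInv m f s) (hs : Step m s s') :
    IsExtension m f s'.list s.list ∨ s'.list = s.list ∧ s'.rank m < s.rank m := by
  cases hs with
  | discard v k l α β hmin hrw =>
    have hv : Inv m f v := h
    refine .inr ⟨rfl, Prod.Lex.toLex_lt_toLex.2 (.inl (Nat.succ_lt_succ ?_))⟩
    exact Set.ncard_sdiff_singleton_lt_of_mem hmin.1 hv.finite_pairs
  | select v k l α β hmin hrw => exact .inr ⟨rfl, Prod.Lex.toLex_lt_toLex.2 (.inl (Nat.succ_pos _))⟩
  | reduce v γ γ' hred =>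
    exact .inr ⟨rfl, Prod.Lex.toLex_lt_toLex.2 (.inr ⟨rfl, hred.withBotDegree_lt⟩)⟩
  | insert v γ hirr hγ =>
    obtain ⟨v, k, l, α, β, rfl, hR⟩ := h
    exact .inl ⟨hR.inv_append.valid, γ, rfl, hR.insertedAfter hirr⟩
  | record v γ hγ =>
    obtain ⟨v, k, l, α, β, rfl, hR⟩ := h
    refine .inl ⟨hR.inv_append.valid, γ, rfl, hR.insertedAfter fun γ' hred => ?_⟩
    obtain ⟨-, -, hγ0, -⟩ := hred
    exact hγ0 hγ

theorem not_exists_infinite_run : ¬ ∃ run : ℕ → State K n r,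
    run 0 = init m f ∧ ∀ t, Step m (run t) (run (t + 1)) := by
  rintro ⟨run, h0, hstep⟩
  have hreach (t : ℕ) : Reachable m f (run t) := by
    induction t with
    | zero => exact h0 ▸ .refl
    | succ t ih => exact .tail ih (hstep t)
  have hwf : WellFounded (Prod.Lex (IsExtension (r := r) m f)
      ((· < ·) : ℕ ×ₗ WithBot m.syn → _ → Prop)) :=
    wellFounded_isExtension.prod_lex wellFounded_lt
  refine (wellFounded_iff_isEmpty_descending_chain.1 hwf).false
    ⟨fun t => ((run t).list, (run t).rank m), fun t => Prod.lex_iff.2 ?_⟩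
  exact (hreach t).stateInv.isExtension_or_rank_lt (hstep t)

end Termination

section Output

variable {K : Type*} [Field K] {n r : ℕ} {m : MonomialOrder (Fin n)}
  {f : Fin r → MvPolynomial (Fin n) K} {G : List (SigPoly K n r)} {v : Vars K n r}
  {p q : MvPolynomial (Fin n) K} {α β γ : SigPoly K n r} {k l : ℕ} {i : Fin r} {s : State K n r}

lemma Inv.exists_isMinimalPair (h : Inv m f v) (hP : v.P.Nonempty) :
    ∃ k l α β, IsMinimalPair m v k l α β := by
  obtain ⟨⟨k, l⟩, hp⟩ := hP
  obtain ⟨-, α, β, hk, hl, -⟩ := h.pairs_subset hp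
  obtain ⟨_, ⟨k, l, α, β, hp, hk, hl, rfl⟩, hmin⟩ := exists_minimalFor_of_wellFoundedLT
    (fun τ => ∃ k l α β, (k, l) ∈ v.P ∧ v.G[k]? = some α ∧ v.G[l]? = some β ∧
      (sPair m α β).sig = τ) (key m) ⟨_, k, l, α, β, hp, hk, hl, rfl⟩
  refine ⟨k, l, α, β, hp, hk, hl, fun k' l' α' β' hp' hk' hl' hlt => ?_⟩
  rw [Signature.lt_iff_key_lt] at hlt
  exact hlt.not_ge (hmin ⟨k', l', α', β', hp', hk', hl', rfl⟩ hlt.le)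

lemma exists_step_reducing (γ : SigPoly K n r) : ∃ s', Step m (.reducing v γ) s' := by
  by_cases h0 : γ.poly = 0
  · exact ⟨_, .record v γ h0⟩
  by_cases hred : ∃ γ', RegRedStep m v.G γ γ'
  · obtain ⟨γ', hγ'⟩ := hred
    exact ⟨_, .reduce v γ γ' hγ'⟩
  · exact ⟨_, .insert v γ (not_exists.1 hred) h0⟩

lemma StateInv.eq_main_of_final (h : StateInv m f s) (hs : ∀ s', ¬ Step m s s') :
    ∃ v : Vars K n r, s = .main v ∧ v.P = ∅ := by
  rcases s with v | ⟨v, γ⟩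
  · refine ⟨v, rfl, Set.not_nonempty_iff_eq_empty.1 fun hP => ?_⟩
    obtain ⟨k, l, α, β, hmin⟩ := Inv.exists_isMinimalPair h hP
    by_cases hrw : PairRewritable m v k l α β
    · exact hs _ (.discard v k l α β hmin hrw)
    · exact hs _ (.select v k l α β hmin hrw)
  · obtain ⟨s', hs'⟩ := exists_step_reducing (m := m) (v := v) γ
    exact absurd hs' (hs s')

lemma Inv.isComplete_of_pairs_eq_empty (h : Inv m f v) (hP : v.P = ∅) : IsComplete m f v.G ⊤ :=
  h.isComplete fun _ _ _ _ hp => by simp [hP] at hp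

lemma IsComplete.isGroebnerBasis (h : IsComplete m f G ⊤) :
    IsGroebnerBasis m (Ideal.span (Set.range f)) (polys G) := by
  have hsub : polys G ⊆ Ideal.span (Set.range f) := by
    rintro _ ⟨α, hα, rfl⟩
    exact (h.valid α hα).mem_span_range
  refine ⟨G.finite_toSet.image SigPoly.poly, hsub, le_antisymm ?_ ?_⟩
  · exact Ideal.span_mono fun _ ⟨p, hp, h0, ht⟩ => ⟨p, hsub hp, h0, ht⟩
  · refine Ideal.span_le.2 ?_
    rintro _ ⟨p, hp, h0, rfl⟩
    rw [← Set.image_univ] at hp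
    obtain ⟨τ, -, hτ⟩ := exists_hasSig_of_mem_span_image (m := m) hp h0
    obtain ⟨β, hβ, b, hβ0, hb, -⟩ := h.exists_reducer hτ h0 trivial
    have hmem : monomial (m.degree β.poly) (1 : K) ∈ leadIdeal m (polys G) :=
      Ideal.subset_span ⟨_, ⟨β, hβ, rfl⟩, hβ0, rfl⟩
    have hmul := Ideal.mul_mem_left _ (monomial b (1 : K)) hmem
    rwa [monomial_mul, one_mul, hb] at hmul

lemma eq_of_forall_exists_degree_le {I J : Ideal (MvPolynomial (Fin n) K)} (hJI : J ≤ I)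
    (h : ∀ g ∈ I, g ≠ 0 → ∃ p ∈ J, p ≠ 0 ∧ m.degree p ≤ m.degree g) : J = I := by
  refine hJI.antisymm fun g hg => ?_
  induction hd : m.toSyn (m.degree g) using WellFoundedLT.induction generalizing g with
  | _ _ ih =>
  subst hd
  by_cases hg0 : g = 0
  · exact hg0 ▸ J.zero_mem
  obtain ⟨p, hp, hp0, hle⟩ := h g hg hg0
  have hmul : ltQuot m g p * p ∈ J := J.mul_mem_left _ hp
  refine (Submodule.sub_mem_iff_left J hmul).1 ?_
  by_cases hne : g - ltQuot m g p * p = 0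
  · exact hne ▸ J.zero_mem
  · exact ih _ (degree_sub_ltQuot_mul_lt hp0 hle hne) _ (sub_mem hg (hJI hmul)) rfl

lemma Inv.mul_mem_idealBelow (h : Inv m f v) (hq : q ∈ v.S i) : q * f i ∈ idealBelow f i := by
  rw [h.quos_eq] at hq
  obtain ⟨δ, hδ, h0, rfl, rfl⟩ := hq
  simpa [h0] using (h.valid δ (List.mem_of_mem_drop hδ)).sub_mul_mem

lemma Inv.quo_mem_of_poly_eq_zero (h : Inv m f v) (hα : α ∈ v.G) (h0 : α.poly = 0)
    (hf : f α.ind ≠ 0) : α.quo ∈ v.S α.ind := by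
  rw [h.quos_eq]
  refine ⟨α, ?_, h0, rfl, rfl⟩
  obtain ⟨k, hk⟩ := List.mem_iff_getElem?.1 hα
  have hrk : r ≤ k := by
    by_contra! hkr
    obtain rfl := Option.some_injective _ ((h.initial ⟨k, hkr⟩).symm.trans hk)
    exact hf h0
  refine List.mem_iff_getElem?.2 ⟨k - r, ?_⟩
  rwa [List.getElem?_drop, Nat.add_sub_cancel' hrk]

lemma Inv.sup_span_eq_colon (h : Inv m f v) (hc : IsComplete m f v.G ⊤) (hi : f i ≠ 0) :
    idealBelow f i ⊔ Ideal.span (v.S i) = (idealBelow f i).colon {f i} := by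
  refine eq_of_forall_exists_degree_le (m := m) (sup_le (fun p hp => ?_) ?_) fun g hg hg0 => ?_
  · exact Submodule.mem_colon_singleton.2 (Ideal.mul_mem_right _ _ hp)
  · exact Ideal.span_le.2 fun q hq => Submodule.mem_colon_singleton.2 (h.mul_mem_idealBelow hq)
  have hsyz : HasSig m f (i, m.degree g) 0 := by
    refine ⟨g, hg0, rfl, ?_⟩
    rw [zero_sub, neg_mem_iff]
    exact Submodule.mem_colon_singleton.1 hg
  rcases hc.detectsSyzygy hsyz trivial with ⟨δ, hδ, h0, hdvd⟩ | ⟨δ, hδ, hlt, h0, hle⟩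
  · obtain ⟨rfl, hle⟩ := Signature.divides_iff.1 hdvd
    have hvalid := h.valid δ hδ
    exact ⟨δ.quo, Ideal.mem_sup_right (Ideal.subset_span (h.quo_mem_of_poly_eq_zero hδ h0 hi)),
      hvalid.quo_ne_zero, hvalid.degree_quo.trans_le hle⟩
  · exact ⟨δ.poly, Ideal.mem_sup_left ((h.valid δ hδ).mem_idealBelow hlt), h0, hle⟩

namespace Reducing

lemma not_degree_le_of_mem_idealBelow (h : Reducing m f v k l α β γ)
    (hp : p ∈ idealBelow f γ.ind) (hp0 : p ≠ 0) : ¬ m.degree p ≤ m.degree γ.quo := by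
  intro hle
  obtain ⟨j, δ, a, hj, hsig, hrw, -⟩ := h.exists_parent
  have hδ := (h.inv.valid δ (List.mem_of_getElem? hj)).termMul (a := a) one_ne_zero
  have hquo : m.degree (monomial a 1 * δ.quo) = m.degree γ.quo := by
    rw [h.valid.degree_quo, ← hsig]
    exact hδ.degree_quo
  have hind : δ.ind = γ.ind := (Signature.divides_iff.1 ⟨a, hsig⟩).1
  obtain ⟨ρ, hρ, hpρ⟩ := exists_hasSig_of_mem_span_image (m := m) hp hp0
  obtain ⟨ε, hε, b, hε0, hb, hkey⟩ := h.isComplete.exists_reducer hpρ hp0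
    (LowerSet.mem_Iio_iff.2 (Signature.key_lt_key_of_fst_lt hρ))
  obtain ⟨i, hi⟩ := List.mem_iff_getElem?.1 hε
  refine hrw ⟨i, ε, hi, .inr (.inr ⟨?_, hε0, ?_⟩)⟩
  · exact hind ▸ (Signature.fst_le_of_key_le hkey).trans_lt hρ
  · exact hquo ▸ (hb ▸ le_add_self).trans hle

lemma not_degree_le_of_mem (h : Reducing m f v k l α β γ) (hγ : γ.poly = 0)
    (hq : q ∈ v.S γ.ind) : ¬ m.degree q ≤ m.degree γ.quo := by
  intro hle
  rw [h.inv.quos_eq] at hq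
  obtain ⟨δ, hδ, h0, hind, rfl⟩ := hq
  have hmem := List.mem_of_mem_drop hδ
  rw [(h.inv.valid δ hmem).degree_quo, h.valid.degree_quo] at hle
  refine (h.insertedAfter ?_).not_divides δ hmem h0 (Signature.divides_iff.2 ⟨hind, hle⟩)
  rintro γ' ⟨-, -, hγ0, -⟩
  exact hγ0 hγ

end Reducing

end Output

end SGB

theorem mainTheorem3 {K : Type*} [Field K] {n r : ℕ} (m : MonomialOrder (Fin n))
    (f : Fin r → MvPolynomial (Fin n) K) :
    -- termination, whatever choices are made: no infinite run, and a run can only stop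
    -- at the head of the main loop with an empty set of pairs
    ((¬ ∃ run : ℕ → SGB.State K n r,
        run 0 = SGB.init m f ∧ ∀ t, SGB.Step m (run t) (run (t + 1))) ∧
      ∀ s : SGB.State K n r, SGB.Reachable m f s → (∀ s', ¬ SGB.Step m s s') →
        ∃ v : SGB.Vars K n r, s = SGB.State.main v ∧ v.P = ∅) ∧
    -- the output
    (∀ v : SGB.Vars K n r, SGB.Reachable m f (SGB.State.main v) → v.P = ∅ →
      SGB.IsGroebnerBasis m (Ideal.span (Set.range f)) (SGB.polys v.G) ∧
      ∀ i : Fin r, f i ≠ 0 →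
        SGB.idealBelow f i ⊔ Ideal.span (v.S i) = (SGB.idealBelow f i).colon {f i}) ∧
    -- whenever the regular reduction ends with zero, so that `γ.quo` is about to be inserted
    -- in `v.S γ.ind`
    (∀ (v : SGB.Vars K n r) (γ : SGB.SigPoly K n r),
      SGB.Reachable m f (SGB.State.reducing v γ) → γ.poly = 0 →
        γ.quo ≠ 0 ∧
        (∀ p ∈ SGB.idealBelow f γ.ind, p ≠ 0 → ¬ m.degree p ≤ m.degree γ.quo) ∧
        ∀ h ∈ v.S γ.ind, ¬ m.degree h ≤ m.degree γ.quo) := by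
  refine ⟨⟨SGB.not_exists_infinite_run, fun s hs => hs.stateInv.eq_main_of_final⟩,
    fun v hv hP => ?_, fun v γ hs hγ => ?_⟩
  · have hinv : SGB.Inv m f v := hv.stateInv
    have hc := hinv.isComplete_of_pairs_eq_empty hP
    exact ⟨hc.isGroebnerBasis, fun i hi => hinv.sup_span_eq_colon hc hi⟩
  · obtain ⟨v, k, l, α, β, rfl, hred⟩ := hs.stateInv
    exact ⟨hred.valid.quo_ne_zero, fun p hp hp0 => hred.not_degree_le_of_mem_idealBelow hp hp0,
      fun q hq => hred.not_degree_le_of_mem hγ hq⟩
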